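/- Let $M$ be a smooth finite-dimensional manifold with projection $\pi\colon TM\to M$, let $T_2$ be a smooth pseudo-Riemannian metric on $M$ and let $U,x^0\in\mathcal C^\infty(M)$. On $TM$ let $\theta_{v_a}=\pi^*(i_{v_a}T_2)$ be the Liouville form, $\omega_2=d\theta$, $T(v_a)=\tfrac12T_2(v_a,v_a)$, $H=T+U$ (functions and forms on $M$ are pulled back to $TM$), and $\dot x^0(v_a)=\langle dx^0,v_a\rangle$. Let $D$ be the equation of motion of the conservative system $(M,T_2,dU)$, i.e. the smooth vector field on $TM$ with $\pi_*D_{v_a}=v_a$ and $i_D\omega_2+dT+dU=0$. Let $$\mathcal R=\{v_a\in TM:\ \dot x^0(v_a)\neq0,\ \|dx^0\|^2_a\neq0\},\qquad \|dx^0\|^2=T_2(\operatorname{grad}x^0,\operatorname{grad}x^0),$$ an open subset of $TM$. The modification of $D$ by the time constraint $\dot x^0=\mathrm{const}$ is the field $\overline D$ such that $$i_{\overline D}\,\omega_2+dT+dU\equiv0\ (\mathrm{mod}\ dx^0),\qquad \overline D(\dot x^0)=0 .$$ On $\mathcal R$ put $\overline\theta=\theta-\frac{H}{\dot x^0}\,dx^0$.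 There is a smooth vector field $\overline D$ on $\mathcal R$ that is the modification of $D$ by the time constraint; on each open $W\subseteq\mathcal R$ it is the only smooth field with the two defining properties, and it has the following properties. 1. For every open $W\subseteq\mathcal R$, a smooth vector field $X$ on $W$ satisfies $$i_X\,d\overline\theta+\frac{H}{\dot x^0}\,d\dot x^0=0$$ if and only if $X=\overline D$ on $W$. 2. Let $u$ be a smooth vector field on an open set $N\subseteq M$ with $u(N)\subseteq\mathcal R$, and let $u^0=u(x^0)=u^*\dot x^0$. If $u$ is an intermediate integral of $\overline D$ (that is, $\overline D$ is tangent to the section $u\colon N\to TM$), then $$i_u\,d(u^*\overline\theta)+\frac{H(u)}{u^0}\,du^0=0\quad\text{on }N. \qquad(*)$$ If moreover the set of points of $N$ where $H(u)\neq0$ is dense in $N$, then conversely every $u$ satisfying $(*)$ is an intermediate integral of $\overline D$; so under this condition $u$ is an intermediate integral of $\overline D$ if and only if $(*)$ holds. -/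

import Mathlib

open Set Bundle
open scoped Manifold ContDiff

noncomputable section

namespace TimeConstraint

/-! ### Exterior derivative of 1-forms on manifolds without boundary -/

section ExteriorDerivative

variable {F : Type*} [NormedAddCommGroup F] [NormedSpace ℝ F]
  {K : Type*} [TopologicalSpace K] (J : ModelWithCorners ℝ F K)
  {N : Type*} [TopologicalSpace N] [ChartedSpace K N]

/-- (Not necessarily continuous) 1-forms on the manifold `N`. -/
abbrev OneForm : Type _ := (p : N) → (TangentSpace J p →L[ℝ] ℝ)

variable {J} in
/-- The expression of the 1-form `β` in the preferred chart `φ` at `p`, that is the pull-back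
`(φ⁻¹)^* β`, as a differential form on the model vector space. -/
def chartForm (β : OneForm J (N := N)) (p : N) : F → F [⋀^Fin 1]→L[ℝ] ℝ := fun y =>
  ContinuousAlternatingMap.ofSubsingleton ℝ F ℝ (0 : Fin 1)
    ((β ((extChartAt J p).symm y)).comp (mfderiv 𝓘(ℝ, F) J (extChartAt J p).symm y))

variable {J} in
/-- The value `(dβ)_p (v, w)` of the exterior derivative of a 1-form `β` on a manifold without
boundary: `(dβ)_p = φ^* d((φ⁻¹)^* β)`, computed in the preferred chart `φ` at `p`. -/
def extD [J.Boundaryless] (β : OneForm J (N := N)) (p : N) (v w : TangentSpace J p) : ℝ :=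
  extDeriv (chartForm β p) (extChartAt J p p)
    ![mfderiv J 𝓘(ℝ, F) (extChartAt J p) p v, mfderiv J 𝓘(ℝ, F) (extChartAt J p) p w]

/-- The vector field `X` on `N` is smooth on the set `W`. -/
def SmoothFieldOn (X : (p : N) → TangentSpace J p) (W : Set N)
    [IsManifold J 1 N] : Prop :=
  ContMDiffOn J J.tangent ∞ (fun p => (⟨p, X p⟩ : TangentBundle J N)) W

end ExteriorDerivative

/-! ### Mechanics on the tangent bundle -/

variable (E : Type*) [NormedAddCommGroup E] [NormedSpace ℝ E]
  (M : Type*) [TopologicalSpace M] [ChartedSpace E M] [IsManifold 𝓘(ℝ, E) ∞ M]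

/-- A smooth pseudo-Riemannian metric: a smooth field of nondegenerate symmetric bilinear forms. -/
structure PseudoMetric where
  /-- the bilinear form on each tangent space -/
  inner (a : M) : TangentSpace 𝓘(ℝ, E) a →L[ℝ] TangentSpace 𝓘(ℝ, E) a →L[ℝ] ℝ
  symm (a : M) (v w : TangentSpace 𝓘(ℝ, E) a) : inner a v w = inner a w v
  nondegenerate (a : M) (v : TangentSpace 𝓘(ℝ, E) a) (hv : ∀ w, inner a v w = 0) : v = 0
  contMDiff : ContMDiff 𝓘(ℝ, E) (𝓘(ℝ, E).prod 𝓘(ℝ, E →L[ℝ] E →L[ℝ] ℝ)) ∞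
    (fun a => TotalSpace.mk' (E →L[ℝ] E →L[ℝ] ℝ)
      (E := fun a : M => TangentSpace 𝓘(ℝ, E) a →L[ℝ] TangentSpace 𝓘(ℝ, E) a →L[ℝ] ℝ)
      a (inner a))

/-- The tangent bundle `TM`. -/
abbrev TM : Type _ := TangentBundle 𝓘(ℝ, E) M

/-- The model with corners of the manifold `TM`. -/
abbrev modelTM : ModelWithCorners ℝ (E × E) (ModelProd E E) := 𝓘(ℝ, E).tangent

variable {E M}

/-- Vector fields on `TM` (no regularity required). -/
abbrev FieldTM (E : Type*) [NormedAddCommGroup E] [NormedSpace ℝ E]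
    (M : Type*) [TopologicalSpace M] [ChartedSpace E M] [IsManifold 𝓘(ℝ, E) ∞ M] : Type _ :=
  (p : TM E M) → TangentSpace (modelTM E) p

/-- The differential at `p ∈ TM` of the canonical projection `π : TM → M`. -/
def projDeriv (p : TM E M) : TangentSpace (modelTM E) p →L[ℝ] TangentSpace 𝓘(ℝ, E) p.proj :=
  mfderiv (modelTM E) 𝓘(ℝ, E) (fun q : TM E M => q.proj) p

/-- The differential of a function on `TM`. -/
def dTM (f : TM E M → ℝ) : OneForm (modelTM E) (N := TM E M) := mvfderiv (modelTM E) f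

/-- The differential of a function on `M`. -/
def dM (f : M → ℝ) : OneForm 𝓘(ℝ, E) (N := M) := mvfderiv 𝓘(ℝ, E) f

/-- The function on `TM` obtained from a function on `M` by pull-back. -/
def lift (f : M → ℝ) : TM E M → ℝ := fun p => f p.proj

/-- The function `ḟ` on `TM`, `ḟ(v_a) = ⟨df, v_a⟩`. -/
def dot (f : M → ℝ) : TM E M → ℝ := fun p => dM f p.proj p.2

/-- The Liouville form on `TM`: `θ_{v_a} = π^*(i_{v_a} T₂)`. -/
def liouville (g : PseudoMetric E M) : OneForm (modelTM E) (N := TM E M) :=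
  fun p => (g.inner p.proj p.2).comp (projDeriv p)

/-- The kinetic energy `T(v_a) = ½ ⟨θ, v_a⟩ = ½ T₂(v_a, v_a)`. -/
def kinetic (g : PseudoMetric E M) : TM E M → ℝ :=
  fun p => (1 / 2) * g.inner p.proj p.2 p.2

/-- The Hamiltonian `H = T + U`. -/
def hamiltonian (g : PseudoMetric E M) (U : M → ℝ) : TM E M → ℝ :=
  fun p => kinetic g p + lift U p

/-- A second order differential equation: `π_*(D_{v_a}) = v_a`. -/
def IsSecondOrder (D : FieldTM E M) : Prop := ∀ p : TM E M, projDeriv p (D p) = p.2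

/-- The form of force of `D`, i.e. the form `α` such that `i_D ω₂ + dT + α = 0`, `ω₂ = dθ`
(evaluated at `ξ ∈ T_p(TM)`). -/
def forceForm (g : PseudoMetric E M) (D : FieldTM E M) (p : TM E M)
    (ξ : TangentSpace (modelTM E) p) : ℝ :=
  -(extD (liouville g) p (D p) ξ + dTM (kinetic g) p ξ)

/-- `D` is the differential equation of the motion of the conservative system `(M, T₂, dU)`:
the smooth second order differential equation with `i_D ω₂ + dT + dU = 0`. -/
structure IsMotionField (g : PseudoMetric E M) (U : M → ℝ) (D : FieldTM E M) : Prop where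
  smooth : SmoothFieldOn (modelTM E) D univ
  secondOrder : IsSecondOrder D
  newton : ∀ (p : TM E M) (ξ : TangentSpace (modelTM E) p),
    forceForm g D p ξ = dTM (lift U) p ξ

/-- On `W ⊆ TM`, the field `X` is the modification of `D` by the time constraint `ẋ⁰ = const`:
`i_X ω₂ + dT + α ≡ 0 (mod dx⁰)`, where `α` is the form of force of `D`, and `X ẋ⁰ = 0`. -/
def IsTimeModification (g : PseudoMetric E M) (D : FieldTM E M) (x0 : M → ℝ)
    (W : Set (TM E M)) (X : FieldTM E M) : Prop :=
  ∀ p ∈ W,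
    (∃ A : ℝ, ∀ ξ : TangentSpace (modelTM E) p,
      extD (liouville g) p (X p) ξ + dTM (kinetic g) p ξ + forceForm g D p ξ
        = A * dTM (lift x0) p ξ) ∧
    dTM (dot x0) p (X p) = 0

/-- The modified Liouville form `θ̄ = θ - (H / ẋ⁰) dx⁰`. -/
def liouvilleBar (g : PseudoMetric E M) (U x0 : M → ℝ) : OneForm (modelTM E) (N := TM E M) :=
  fun p => liouville g p - (hamiltonian g U p / dot x0 p) • dTM (lift x0) p

/-- The equation `i_X dθ̄ + (H / ẋ⁰) dẋ⁰ = 0` on `W`. -/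
def NewtonBar (g : PseudoMetric E M) (U x0 : M → ℝ) (W : Set (TM E M)) (X : FieldTM E M) : Prop :=
  ∀ p ∈ W, ∀ ξ : TangentSpace (modelTM E) p,
    extD (liouvilleBar g U x0) p (X p) ξ
      + hamiltonian g U p / dot x0 p * dTM (dot x0) p ξ = 0

/-- A vector field `u` on `M`, as a section `M → TM`. -/
def sec (u : (a : M) → TangentSpace 𝓘(ℝ, E) a) : M → TM E M := fun a => ⟨a, u a⟩

/-- The differential `u_*` of the section `u : M → TM` at `a`. -/
def secDeriv (u : (a : M) → TangentSpace 𝓘(ℝ, E) a) (a : M) :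
    TangentSpace 𝓘(ℝ, E) a →L[ℝ] TangentSpace (modelTM E) (sec u a) :=
  mfderiv 𝓘(ℝ, E) (modelTM E) (sec u) a

/-- The field `u`, defined on `N ⊆ M`, is an intermediate integral of the field `X` on `TM`:
`X` is tangent to the section `u`. -/
def IsIntermediateIntegral (X : FieldTM E M) (N : Set M)
    (u : (a : M) → TangentSpace 𝓘(ℝ, E) a) : Prop :=
  ∀ a ∈ N, X (sec u a) ∈ LinearMap.range (secDeriv u a).toLinearMap

/-- The pull-back `u^* β` of a 1-form on `TM` by the section `u`. -/
def pullSec (u : (a : M) → TangentSpace 𝓘(ℝ, E) a) (β : OneForm (modelTM E) (N := TM E M)) :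
    OneForm 𝓘(ℝ, E) (N := M) :=
  fun a => (β (sec u a)).comp (secDeriv u a)

/-- The equation `i_u d(u^* θ̄) + (H(u) / u⁰) du⁰ = 0` on `N`, with `u⁰ = u(x⁰) = u^* ẋ⁰`. -/
def IntermediateBar (g : PseudoMetric E M) (U x0 : M → ℝ) (N : Set M)
    (u : (a : M) → TangentSpace 𝓘(ℝ, E) a) : Prop :=
  ∀ a ∈ N, ∀ w : TangentSpace 𝓘(ℝ, E) a,
    extD (pullSec u (liouvilleBar g U x0)) a (u a) w
      + hamiltonian g U (sec u a) / dM x0 a (u a) * dM (fun b => dM x0 b (u b)) a w = 0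

section Gradient

/-- The metric as a bilinear form on the tangent space at `a`. -/
def PseudoMetric.bilin (g : PseudoMetric E M) (a : M) :
    LinearMap.BilinForm ℝ (TangentSpace 𝓘(ℝ, E) a) :=
  LinearMap.mk₂ ℝ (fun v w => g.inner a v w) (by simp) (by simp) (by simp) (by simp)

theorem PseudoMetric.bilin_nondegenerate (g : PseudoMetric E M) (a : M) :
    (g.bilin a).Nondegenerate := by
  refine ⟨fun v hv => g.nondegenerate a v hv, fun v hv => g.nondegenerate a v fun w => ?_⟩
  rw [g.symm]
  exact hv w

variable [FiniteDimensional ℝ E]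

instance finiteDimensional_tangentSpace (a : M) :
    FiniteDimensional ℝ (TangentSpace 𝓘(ℝ, E) a) := inferInstanceAs (FiniteDimensional ℝ E)

/-- The gradient of a function: the vector field with `i_{grad f} T₂ = df`. -/
def grad (g : PseudoMetric E M) (f : M → ℝ) (a : M) : TangentSpace 𝓘(ℝ, E) a :=
  ((g.bilin a).toDual (g.bilin_nondegenerate a)).symm (dM f a).toLinearMap

theorem inner_grad (g : PseudoMetric E M) (f : M → ℝ) (a : M) (w : TangentSpace 𝓘(ℝ, E) a) :
    g.inner a (grad g f a) w = dM f a w :=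
  LinearMap.BilinForm.apply_toDual_symm_apply (hB := g.bilin_nondegenerate a)
    (dM f a).toLinearMap w

/-- The open subset of `TM` where `ẋ⁰ ≠ 0` and `‖dx⁰‖² = T₂(grad x⁰, grad x⁰) ≠ 0`. -/
def regularDomain (g : PseudoMetric E M) (x0 : M → ℝ) : Set (TM E M) :=
  {p | dot x0 p ≠ 0 ∧ g.inner p.proj (grad g x0 p.proj) (grad g x0 p.proj) ≠ 0}

end Gradient

end TimeConstraint

end

open TimeConstraint

/-! In a chart of TM a tangent vector is a pair (base part, fibre part). Let V be the vertical lift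
of grad x⁰. Then i_V ω₂ = dx⁰ and V(ẋ⁰) = ‖dx⁰‖². As ω₂ is nondegenerate, the congruence mod dx⁰
says X = D + aV, and X(ẋ⁰) = 0 fixes a. Hence D̄ = D − cV with c = D(ẋ⁰)/‖dx⁰‖²
(`modification_iff`), which is smooth because the gradient is.

D̄ solves the barred equation: i_D̄ ω₂ = −dH − c dx⁰, and evaluating this on D̄ itself gives D̄(H) =
−cẋ⁰, so D̄(H/ẋ⁰) = −c; everything cancels by ẋ⁰ d(H/ẋ⁰) + (H/ẋ⁰) dẋ⁰ = dH
(`newtonBarForm_modifiedVector`). Conversely, where H ≠ 0, pairing a solution X with itself gives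
X(ẋ⁰) = 0, vertical test vectors give X(x⁰) = ẋ⁰, and what remains is the defining congruence
(`eq_modifiedVector_of_newtonBarForm`). Zeros of H in the regular domain are reached by continuity,
since V(H) = ẋ⁰ ≠ 0 makes them limits of points with H ≠ 0.

For a section u, D̄ being of second order, tangency means u_*u = D̄ along u. Pull-back commutes with
d (`extD_pullback`), so (*) is the barred equation for u_*u, tested only on vectors tangent to the
section. This still suffices where H ≠ 0 (`eq_modifiedVector_of_newtonBarForm_section`), because
u_*u and D̄ differ by a vertical vector. The section may stay inside H = 0, which is why density is
assumed there. -/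

noncomputable section

namespace TimeConstraint

/-! ### Calculus of `extD`: coordinate formula, d(β − f dh), pull-backs. -/

section ExteriorDerivativeCalculus

variable {F : Type*} [NormedAddCommGroup F] [NormedSpace ℝ F]
  {K : Type*} [TopologicalSpace K] {J : ModelWithCorners ℝ F K}
  {N : Type*} [TopologicalSpace N] [ChartedSpace K N]

/-- The 1-form `β` in the preferred chart at `p`, as a field of linear forms. -/
def chartRep (β : OneForm J (N := N)) (p : N) : F → F →L[ℝ] ℝ := fun y =>
  (β ((extChartAt J p).symm y)).comp (mfderiv 𝓘(ℝ, F) J (extChartAt J p).symm y)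

theorem extDeriv_ofSubsingleton {f : F → F →L[ℝ] ℝ} {x : F} (hf : DifferentiableAt ℝ f x)
    (v w : F) :
    extDeriv (fun y => ContinuousAlternatingMap.ofSubsingleton ℝ F ℝ (0 : Fin 1) (f y)) x ![v, w]
      = fderiv ℝ f x v w - fderiv ℝ f x w v := by
  have h : DifferentiableAt ℝ
      (fun y => ContinuousAlternatingMap.ofSubsingleton ℝ F ℝ (0 : Fin 1) (f y)) x :=
    (ContinuousAlternatingMap.ofSubsingletonLIE (𝕜 := ℝ) (E := F) (F := ℝ) (0 : Fin 1)).toContinuousLinearEquiv.differentiableAt.comp x hf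
  rw [extDeriv_apply h, Fin.sum_univ_two]
  have key : ∀ u u' : F, fderiv ℝ (fun y => f y u) x u' = fderiv ℝ f x u' u := fun u u' => by
    rw [fderiv_clm_apply hf (differentiableAt_const u)]
    simp
  simp [Fin.removeNth, key, sub_eq_add_neg]

/-- With `G` the metric in a chart, the field differentiated here is the coordinate expression of
the Liouville form. -/
theorem hasFDerivAt_bilinear_comp_fst {G : F → F →L[ℝ] F →L[ℝ] ℝ} {x : F}
    (hG : DifferentiableAt ℝ G x) (v : F) :
    ∃ B : F × F →L[ℝ] F × F →L[ℝ] ℝ,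
      HasFDerivAt (fun y : F × F => (G y.1 y.2).comp (ContinuousLinearMap.fst ℝ F F)) B (x, v) ∧
      ∀ X ξ : F × F, B X ξ = fderiv ℝ G x X.1 v ξ.1 + G x X.2 ξ.1 := by
  have hf : DifferentiableAt ℝ (Prod.fst : F × F → F) (x, v) := differentiableAt_fst
  have hs : DifferentiableAt ℝ (Prod.snd : F × F → F) (x, v) := differentiableAt_snd
  have h1 : DifferentiableAt ℝ (fun y : F × F => G y.1) (x, v) :=
    DifferentiableAt.comp (g := G) (x, v) hG hf
  have h2 := h1.clm_apply hs
  have h3 := h2.clm_comp (differentiableAt_const (ContinuousLinearMap.fst ℝ F F))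
  refine ⟨_, h3.hasFDerivAt, fun X ξ => ?_⟩
  have h4 : fderiv ℝ (fun y : F × F => G y.1) (x, v) =
      fderiv ℝ G x ∘L ContinuousLinearMap.fst ℝ F F := by
    rw [← fderiv_fst (p := (x, v))]
    exact fderiv_comp (x, v) (g := G) (f := Prod.fst) hG hf
  have h5 : fderiv ℝ (Prod.snd : F × F → F) (x, v) = ContinuousLinearMap.snd ℝ F F := fderiv_snd
  rw [fderiv_clm_comp h2 (differentiableAt_const _), fderiv_clm_apply h1 hs, h4, h5]
  simp [add_comm]

variable {F₁ : Type*} [NormedAddCommGroup F₁] [NormedSpace ℝ F₁]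

theorem differentiableAt_chart [J.Boundaryless] {f : N → F₁} {p : N}
    (hf : MDifferentiableAt J 𝓘(ℝ, F₁) f p) :
    DifferentiableAt ℝ (fun y => f ((extChartAt J p).symm y)) (extChartAt J p p) := by
  have := hf.2
  simpa [DifferentiableWithinAtProp, writtenInExtChartAt, J.range_eq_univ, Function.comp_def,
    chartAt_self_eq, differentiableWithinAt_univ] using! this

theorem mvfderiv_eq_fderiv [J.Boundaryless] {f : N → F₁} {p : N}
    (hf : MDifferentiableAt J 𝓘(ℝ, F₁) f p) (v : TangentSpace J p) :
    mvfderiv J f p v = fderiv ℝ (fun y => f ((extChartAt J p).symm y)) (extChartAt J p p) v := by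
  rw [hf.mvfderiv]
  rw [J.range_eq_univ, fderivWithin_univ]
  rfl

variable [IsManifold J 1 N]

theorem mfderiv_extChartAt_self_apply (p : N) (v : TangentSpace J p) :
    mfderiv J 𝓘(ℝ, F) (extChartAt J p) p v = v := by
  rw [mfderiv_extChartAt_self]; rfl

theorem extD_eq_fderiv [J.Boundaryless] {β : OneForm J (N := N)} {p : N}
    (hβ : DifferentiableAt ℝ (chartRep β p) (extChartAt J p p)) (v w : TangentSpace J p) :
    extD β p v w = fderiv ℝ (chartRep β p) (extChartAt J p p) v w
      - fderiv ℝ (chartRep β p) (extChartAt J p p) w v := by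
  unfold extD
  rw [mfderiv_extChartAt_self_apply, mfderiv_extChartAt_self_apply]
  exact extDeriv_ofSubsingleton hβ v w

theorem mdifferentiableAt_extChartAt_symm [J.Boundaryless] {p : N} {y : F}
    (hy : y ∈ (extChartAt J p).target) :
    MDifferentiableAt 𝓘(ℝ, F) J (extChartAt J p).symm y := by
  have := mdifferentiableWithinAt_extChartAt_symm (I := J) hy
  rwa [J.range_eq_univ, mdifferentiableWithinAt_univ] at this

omit [IsManifold J 1 N] in
theorem eventually_mem_target [J.Boundaryless] (p : N) :
    ∀ᶠ y in nhds (extChartAt J p p), y ∈ (extChartAt J p).target :=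
  extChartAt_target_mem_nhds p

theorem chartRep_mvfderiv [J.Boundaryless] {h : N → ℝ} {p : N} {y : F}
    (hh : MDifferentiable J 𝓘(ℝ, ℝ) h) (hy : y ∈ (extChartAt J p).target) :
    chartRep (mvfderiv J h) p y = fderiv ℝ (fun z => h ((extChartAt J p).symm z)) y := by
  have h1 := mfderiv_comp y (hh _) (mdifferentiableAt_extChartAt_symm (J := J) hy)
  rw [mfderiv_eq_fderiv] at h1
  exact h1.symm

theorem differentiableAt_chartRep_mvfderiv [J.Boundaryless] [IsManifold J ∞ N] {h : N → ℝ}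
    (hh : ContMDiff J 𝓘(ℝ, ℝ) ∞ h) (p : N) :
    DifferentiableAt ℝ (chartRep (mvfderiv J h) p) (extChartAt J p p) := by
  have e : chartRep (mvfderiv J h) p =ᶠ[nhds (extChartAt J p p)]
      fderiv ℝ (fun z => h ((extChartAt J p).symm z)) := by
    filter_upwards [eventually_mem_target p] with y hy
    exact chartRep_mvfderiv (hh.mdifferentiable (by simp)) hy
  have hs : ContDiffAt ℝ ∞ (fun z => h ((extChartAt J p).symm z)) (extChartAt J p p) := by
    have := contMDiffOn_extChartAt_symm (I := J) (n := ∞) p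
    exact ((hh.comp_contMDiffOn this).contMDiffAt (extChartAt_target_mem_nhds p)).contDiffAt
  exact ((hs.fderiv_right (m := 1) (by norm_cast)).differentiableAt (by simp)).congr_of_eventuallyEq
    e

/-- Closedness of dh: near the centre of the chart `chartRep` is the derivative of the coordinate
expression of `h`, so its own derivative is a Hessian. -/
theorem fderiv_chartRep_mvfderiv_symm [J.Boundaryless] [IsManifold J ∞ N] {h : N → ℝ}
    (hh : ContMDiff J 𝓘(ℝ, ℝ) ∞ h) (p : N) (v w : F) :
    fderiv ℝ (chartRep (mvfderiv J h) p) (extChartAt J p p) v w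
      = fderiv ℝ (chartRep (mvfderiv J h) p) (extChartAt J p p) w v := by
  have e : chartRep (mvfderiv J h) p =ᶠ[nhds (extChartAt J p p)]
      fderiv ℝ (fun z => h ((extChartAt J p).symm z)) := by
    filter_upwards [eventually_mem_target p] with y hy
    exact chartRep_mvfderiv (hh.mdifferentiable (by simp)) hy
  have hs : ContDiffAt ℝ ∞ (fun z => h ((extChartAt J p).symm z)) (extChartAt J p p) := by
    have := contMDiffOn_extChartAt_symm (I := J) (n := ∞) p
    exact ((hh.comp_contMDiffOn this).contMDiffAt (extChartAt_target_mem_nhds p)).contDiffAt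
  rw [e.fderiv_eq]
  exact hs.isSymmSndFDerivAt (by simp; norm_cast) v w

omit [IsManifold J 1 N] in
theorem chartRep_sub_smul (β γ : OneForm J (N := N)) (f : N → ℝ) (p : N) :
    chartRep (fun q => β q - f q • γ q) p =
      fun y => chartRep β p y - f ((extChartAt J p).symm y) • chartRep γ p y := by
  ext y v
  rfl

theorem differentiableAt_chartRep_sub_smul [J.Boundaryless] [IsManifold J ∞ N]
    {β : OneForm J (N := N)} {f h : N → ℝ} {p : N}
    (hβ : DifferentiableAt ℝ (chartRep β p) (extChartAt J p p))
    (hf : MDifferentiableAt J 𝓘(ℝ, ℝ) f p) (hh : ContMDiff J 𝓘(ℝ, ℝ) ∞ h) :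
    DifferentiableAt ℝ (chartRep (fun q => β q - f q • mvfderiv J h q) p) (extChartAt J p p) := by
  rw [chartRep_sub_smul]
  exact hβ.sub ((differentiableAt_chart hf).smul (differentiableAt_chartRep_mvfderiv hh p))

/-- `d(β - f dh) = dβ - df ∧ dh`. -/
theorem extD_sub_smul [J.Boundaryless] [IsManifold J ∞ N]
    {β : OneForm J (N := N)} {f h : N → ℝ} {p : N}
    (hβ : DifferentiableAt ℝ (chartRep β p) (extChartAt J p p))
    (hf : MDifferentiableAt J 𝓘(ℝ, ℝ) f p) (hh : ContMDiff J 𝓘(ℝ, ℝ) ∞ h)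
    (v w : TangentSpace J p) :
    extD (fun q => β q - f q • mvfderiv J h q) p v w = extD β p v w
      - (mvfderiv J f p v * mvfderiv J h p w - mvfderiv J f p w * mvfderiv J h p v) := by
  have hh1 := hh.mdifferentiable (by simp)
  have hf' := differentiableAt_chart hf
  have hd := differentiableAt_chartRep_mvfderiv hh p
  have key : HasFDerivAt (chartRep (fun q => β q - f q • mvfderiv J h q) p)
      (fderiv ℝ (chartRep β p) (extChartAt J p p) -
        (f p • fderiv ℝ (chartRep (mvfderiv J h) p) (extChartAt J p p) +
          (fderiv ℝ (fun y => f ((extChartAt J p).symm y)) (extChartAt J p p)).smulRight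
            (fderiv ℝ (fun y => h ((extChartAt J p).symm y)) (extChartAt J p p))))
      (extChartAt J p p) := by
    rw [chartRep_sub_smul]
    convert! hβ.hasFDerivAt.sub (hf'.hasFDerivAt.smul hd.hasFDerivAt) using 4
    · rw [extChartAt_to_inv]
    · rw [chartRep_mvfderiv hh1 (mem_extChartAt_target p)]
  have hsym := fderiv_chartRep_mvfderiv_symm hh p
  rw [extD_eq_fderiv (differentiableAt_chartRep_sub_smul hβ hf hh), extD_eq_fderiv hβ,
    key.fderiv, mvfderiv_eq_fderiv hf, mvfderiv_eq_fderiv hf, mvfderiv_eq_fderiv (hh1 p),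
    mvfderiv_eq_fderiv (hh1 p)]
  -- The Hessian term `c • B` is symmetric and drops out; only df ⊗ dh survives antisymmetrisation.
  have alg : ∀ (A B : F →L[ℝ] F →L[ℝ] ℝ) (c : ℝ) (k l : F →L[ℝ] ℝ) (v w : F), B v w = B w v →
      (A - (c • B + k.smulRight l)) v w - (A - (c • B + k.smulRight l)) w v =
        A v w - A w v - (k v * l w - k w * l v) := by
    intro A B c k l v w h
    simp only [sub_apply, add_apply, smul_apply, ContinuousLinearMap.smulRight_apply, smul_eq_mul]
    linear_combination -c * h
  exact alg _ _ _ _ _ v w (hsym v w)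

variable {F' : Type*} [NormedAddCommGroup F'] [NormedSpace ℝ F']
  {K' : Type*} [TopologicalSpace K'] {J' : ModelWithCorners ℝ F' K'}
  {N' : Type*} [TopologicalSpace N'] [ChartedSpace K' N'] [IsManifold J' 1 N']

/-- The charts stay centred at `a` and `f a` while the point moves, so their derivatives are not the
identity; each has to be cancelled against the derivative of the inverse chart. -/
theorem chartRep_pullback [J.Boundaryless] [J'.Boundaryless] {f : N' → N} {a : N'} {y : F'}
    (β : OneForm J (N := N)) (hy : y ∈ (extChartAt J' a).target)
    (hf : MDifferentiableAt J' J f ((extChartAt J' a).symm y))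
    (hfy : f ((extChartAt J' a).symm y) ∈ (extChartAt J (f a)).source) :
    chartRep (fun b => (β (f b)).comp (mfderiv J' J f b)) a y =
      (chartRep β (f a) (extChartAt J (f a) (f ((extChartAt J' a).symm y)))).comp
        (fderiv ℝ (fun z => extChartAt J (f a) (f ((extChartAt J' a).symm z))) y) := by
  have hs := mdifferentiableAt_extChartAt_symm (J := J') hy
  have h1 : MDifferentiableAt 𝓘(ℝ, F') J (fun z => f ((extChartAt J' a).symm z)) y :=
    hf.comp y hs
  have h2 := mdifferentiableAt_extChartAt (I := J) (x := f a)
    (y := f ((extChartAt J' a).symm y)) (by rwa [← extChartAt_source J])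
  have h4 := mfderiv_comp y hf hs
  have hv : ∀ v : F', fderiv ℝ (fun z => extChartAt J (f a) (f ((extChartAt J' a).symm z))) y v =
      mfderiv J 𝓘(ℝ, F) (extChartAt J (f a)) (f ((extChartAt J' a).symm y))
        (mfderiv J' J f ((extChartAt J' a).symm y)
          (mfderiv 𝓘(ℝ, F') J' (extChartAt J' a).symm y v)) := by
    intro v
    have h3 := mfderiv_comp y h2 h1
    have h6 : mfderiv 𝓘(ℝ, F') J (fun z => f ((extChartAt J' a).symm z)) y = _ := h4
    rw [mfderiv_eq_fderiv, h6] at h3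
    exact DFunLike.congr_fun h3 v
  have hq : ∀ (q : N) (hq : q ∈ (extChartAt J (f a)).source) (ξ : TangentSpace J q),
      chartRep β (f a) (extChartAt J (f a) q) (mfderiv J 𝓘(ℝ, F) (extChartAt J (f a)) q ξ)
        = β q ξ := by
    intro q hq ξ
    have h5 := mfderivWithin_extChartAt_symm_comp_mfderiv_extChartAt' (I := J) hq
    rw [J.range_eq_univ, mfderivWithin_univ] at h5
    have h7 : mfderiv 𝓘(ℝ, F) J (extChartAt J (f a)).symm (extChartAt J (f a) q)
        (mfderiv J 𝓘(ℝ, F) (extChartAt J (f a)) q ξ) = ξ := DFunLike.congr_fun h5 ξ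
    have e := (extChartAt J (f a)).left_inv hq
    have h8 : ∀ (q' : N) (_ : q' = q) (ξ' : F), (β q' : F → ℝ) ξ' = (β q : F → ℝ) ξ' := by
      rintro _ rfl _
      rfl
    refine (h8 _ e _).trans ?_
    exact congrArg (β q) h7
  ext v
  have := hq _ hfy (mfderiv J' J f ((extChartAt J' a).symm y)
          (mfderiv 𝓘(ℝ, F') J' (extChartAt J' a).symm y v))
  rw [ContinuousLinearMap.comp_apply, hv]
  exact this.symm

omit [IsManifold J 1 N] [IsManifold J' 1 N'] in
theorem mfderiv_eq_fderiv_chart [J.Boundaryless] [J'.Boundaryless] {f : N' → N} {a : N'}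
    (hf : MDifferentiableAt J' J f a) (v : TangentSpace J' a) :
    mfderiv J' J f a v = fderiv ℝ (fun z => extChartAt J (f a) (f ((extChartAt J' a).symm z)))
      (extChartAt J' a a) v := by
  rw [hf.mfderiv, J'.range_eq_univ, fderivWithin_univ]
  rfl

/-- The exterior derivative commutes with pull-backs. -/
theorem extD_pullback [J.Boundaryless] [J'.Boundaryless] [IsManifold J ∞ N] [IsManifold J' ∞ N']
    {f : N' → N} {a : N'} {S : Set N'} (hS : S ∈ nhds a) (hf : ContMDiffOn J' J ∞ f S)
    {β : OneForm J (N := N)}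
    (hβ : DifferentiableAt ℝ (chartRep β (f a)) (extChartAt J (f a) (f a)))
    (v w : TangentSpace J' a) :
    extD (fun b => (β (f b)).comp (mfderiv J' J f b)) a v w =
      extD β (f a) (mfderiv J' J f a v) (mfderiv J' J f a w) := by
  set Φ : F' → F := fun z => extChartAt J (f a) (f ((extChartAt J' a).symm z)) with hΦ
  have hfa : ContMDiffAt J' J ∞ f a := hf.contMDiffAt hS
  have hcont : ContinuousAt (fun y => f ((extChartAt J' a).symm y)) (extChartAt J' a a) := by
    refine ContinuousAt.comp (g := f) ?_ (continuousAt_extChartAt_symm a)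
    rw [extChartAt_to_inv]
    exact hfa.continuousAt
  have hΦa : Φ (extChartAt J' a a) = extChartAt J (f a) (f a) := by simp [hΦ]
  have hΦs : ContDiffAt ℝ ∞ Φ (extChartAt J' a a) := by
    have h1 := (contMDiffAt_iff.1 hfa).2
    rw [J'.range_eq_univ] at h1
    exact h1
  have hΦ2 : DifferentiableAt ℝ (fderiv ℝ Φ) (extChartAt J' a a) :=
    (hΦs.fderiv_right (m := 1) (by norm_cast)).differentiableAt (by simp)
  have e : chartRep (fun b => (β (f b)).comp (mfderiv J' J f b)) a =ᶠ[nhds (extChartAt J' a a)]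
      fun y => (chartRep β (f a) (Φ y)).comp (fderiv ℝ Φ y) := by
    have h1 : ∀ᶠ y in nhds (extChartAt J' a a),
        f ((extChartAt J' a).symm y) ∈ (extChartAt J (f a)).source := by
      refine hcont.eventually_mem ?_
      simpa using extChartAt_source_mem_nhds (I := J) (f a)
    have h2 : ∀ᶠ y in nhds (extChartAt J' a a), (extChartAt J' a).symm y ∈ interior S := by
      refine (continuousAt_extChartAt_symm a).eventually_mem ?_
      simpa using interior_mem_nhds.2 hS
    filter_upwards [h1, h2, eventually_mem_target a] with y hy1 hy2 hy3
    refine chartRep_pullback β hy3 ?_ hy1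
    exact (hf.contMDiffAt (mem_interior_iff_mem_nhds.1 hy2)).mdifferentiableAt (by simp)
  have hc : HasFDerivAt (fun y => chartRep β (f a) (Φ y))
      ((fderiv ℝ (chartRep β (f a)) (extChartAt J (f a) (f a))).comp
        (fderiv ℝ Φ (extChartAt J' a a))) (extChartAt J' a a) := by
    rw [← hΦa]
    rw [← hΦa] at hβ
    exact hβ.hasFDerivAt.comp _ (hΦs.differentiableAt (by simp)).hasFDerivAt
  have hd := (hc.clm_comp hΦ2.hasFDerivAt).congr_of_eventuallyEq e
  have hsym : ∀ v w, fderiv ℝ (fderiv ℝ Φ) (extChartAt J' a a) v w =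
      fderiv ℝ (fderiv ℝ Φ) (extChartAt J' a a) w v :=
    fun v w => hΦs.isSymmSndFDerivAt (by simp; norm_cast) v w
  rw [extD_eq_fderiv hd.differentiableAt, extD_eq_fderiv hβ, hd.fderiv,
    mfderiv_eq_fderiv_chart (hfa.mdifferentiableAt (by simp)),
    mfderiv_eq_fderiv_chart (hfa.mdifferentiableAt (by simp))]
  -- Of the two terms of the product rule, the one with the second derivative of `Φ` is symmetric
  -- and cancels; the other is the pull-back of the derivative of β.
  have alg : ∀ v w : F',
      (((ContinuousLinearMap.compL ℝ F' F ℝ) (chartRep β (f a) (Φ (extChartAt J' a a)))).comp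
        (fderiv ℝ (fderiv ℝ Φ) (extChartAt J' a a)) +
      ((ContinuousLinearMap.compL ℝ F' F ℝ).flip (fderiv ℝ Φ (extChartAt J' a a))).comp
        ((fderiv ℝ (chartRep β (f a)) (extChartAt J (f a) (f a))).comp
          (fderiv ℝ Φ (extChartAt J' a a)))) v w =
      chartRep β (f a) (Φ (extChartAt J' a a)) (fderiv ℝ (fderiv ℝ Φ) (extChartAt J' a a) v w) +
      fderiv ℝ (chartRep β (f a)) (extChartAt J (f a) (f a)) (fderiv ℝ Φ (extChartAt J' a a) v)
        (fderiv ℝ Φ (extChartAt J' a a) w) := fun v w => rfl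
  have fin : ∀ a a' b b' : ℝ, a = a' → (a + b) - (a' + b') = b - b' := fun a a' b b' h => by
    rw [h, add_sub_add_left_eq_sub]
  exact (congrArg₂ (· - ·) (alg v w) (alg w v)).trans (fin _ _ _ _ (congrArg _ (hsym v w)))

end ExteriorDerivativeCalculus

/-! ### Charts of TM, vertical derivatives, and ω₂ in coordinates. -/

section TangentBundleCoordinates

variable {E : Type*} [NormedAddCommGroup E] [NormedSpace ℝ E]
  {M : Type*} [TopologicalSpace M] [ChartedSpace E M] [IsManifold 𝓘(ℝ, E) ∞ M]

theorem extChartAt_TM_target (p : TM E M) :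
    (extChartAt (modelTM E) p).target = (extChartAt 𝓘(ℝ, E) p.proj).target ×ˢ univ := by
  ext y
  simp only [mem_prod, mem_univ, and_true, mfld_simps]
  exact TangentBundle.mem_chart_target_iff (I := 𝓘(ℝ, E)) y p

theorem extChartAt_TM_symm (p : TM E M) {y : E × E}
    (hy : y.1 ∈ (extChartAt 𝓘(ℝ, E) p.proj).target) :
    (extChartAt (modelTM E) p).symm y = ⟨(extChartAt 𝓘(ℝ, E) p.proj).symm y.1,
      mfderiv 𝓘(ℝ, E) 𝓘(ℝ, E) (extChartAt 𝓘(ℝ, E) p.proj).symm y.1 y.2⟩ := by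
  have := tangentMap_chart_symm (I := 𝓘(ℝ, E)) (p := p) (q := ⟨y.1, y.2⟩) (by simpa using hy)
  exact this.symm

theorem extChartAt_TM_apply (p q : TM E M)
    (hq : q.proj ∈ (extChartAt 𝓘(ℝ, E) p.proj).source) :
    extChartAt (modelTM E) p q = (extChartAt 𝓘(ℝ, E) p.proj q.proj,
      mfderiv 𝓘(ℝ, E) 𝓘(ℝ, E) (extChartAt 𝓘(ℝ, E) p.proj) q.proj q.2) := by
  have := tangentMap_chart (I := 𝓘(ℝ, E)) (p := p) (q := q) (by simpa using hq)
  exact congrArg (TotalSpace.toProd E E) this.symm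

theorem extChartAt_TM_self (p : TM E M) :
    extChartAt (modelTM E) p p = (extChartAt 𝓘(ℝ, E) p.proj p.proj, p.2) := by
  rw [extChartAt_TM_apply p p (mem_extChartAt_source _)]
  exact congrArg (Prod.mk _) (mfderiv_extChartAt_self_apply (J := 𝓘(ℝ, E)) p.proj p.2)

theorem contMDiff_proj : ContMDiff (modelTM E) 𝓘(ℝ, E) ∞ (fun q : TM E M => q.proj) :=
  Bundle.contMDiff_proj _

theorem projDeriv_apply (p : TM E M) (ξ : TangentSpace (modelTM E) p) :
    projDeriv p ξ = (ξ : E × E).1 := by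
  unfold projDeriv
  rw [mfderiv_eq_fderiv_chart (contMDiff_proj.mdifferentiable (by simp) p)]
  have e : (fun z : E × E => extChartAt 𝓘(ℝ, E) p.proj
      ((extChartAt (modelTM E) p).symm z).proj) =ᶠ[nhds (extChartAt (modelTM E) p p)]
      Prod.fst := by
    filter_upwards [eventually_mem_target p] with y hy
    rw [extChartAt_TM_target] at hy
    rw [extChartAt_TM_symm p hy.1]
    exact (extChartAt 𝓘(ℝ, E) p.proj).right_inv hy.1
  rw [e.fderiv_eq, fderiv_fst]
  rfl

theorem contMDiff_lift {f : M → ℝ} (hf : ContMDiff 𝓘(ℝ, E) 𝓘(ℝ, ℝ) ∞ f) :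
    ContMDiff (modelTM E) 𝓘(ℝ, ℝ) ∞ (lift f : TM E M → ℝ) :=
  hf.comp contMDiff_proj

theorem dTM_lift {f : M → ℝ} (hf : ContMDiff 𝓘(ℝ, E) 𝓘(ℝ, ℝ) ∞ f) (p : TM E M)
    (ξ : TangentSpace (modelTM E) p) : dTM (lift f) p ξ = dM f p.proj (ξ : E × E).1 := by
  have := mvfderiv_comp_apply p (hf.mdifferentiable (by simp) p.proj)
    (contMDiff_proj.mdifferentiable (by simp) p) ξ
  refine this.trans ?_
  rw [← projDeriv_apply p ξ]
  rfl

theorem contMDiff_dot {f : M → ℝ} (hf : ContMDiff 𝓘(ℝ, E) 𝓘(ℝ, ℝ) ∞ f) :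
    ContMDiff (modelTM E) 𝓘(ℝ, ℝ) ∞ (dot f : TM E M → ℝ) :=
  (contMDiff_snd_tangentBundle_modelSpace ℝ 𝓘(ℝ, ℝ)).comp (hf.contMDiff_tangentMap (by simp))

theorem contMDiff_kinetic (g : PseudoMetric E M) :
    ContMDiff (modelTM E) 𝓘(ℝ, ℝ) ∞ (kinetic g) := by
  have hid : ContMDiff (modelTM E) (modelTM E) ∞ (fun q : TM E M => TotalSpace.mk' E q.proj q.2) :=
    contMDiff_id
  have h := ContMDiff.clm_bundle_apply₂ (F₁ := E) (F₂ := E) (F₃ := ℝ) (E₃ := fun _ : M => ℝ)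
    (b := fun q : TM E M => q.proj) (ψ := fun q => g.inner q.proj)
    (g.contMDiff.comp contMDiff_proj) hid hid
  have h2 := fun q => (contMDiffAt_totalSpace.1 (h q)).2
  simp only [Trivial.fiberBundle_trivializationAt', Trivial.trivialization_apply] at h2
  exact (contMDiff_const (c := (1/2 : ℝ))).mul h2

theorem contMDiff_hamiltonian (g : PseudoMetric E M) {U : M → ℝ}
    (hU : ContMDiff 𝓘(ℝ, E) 𝓘(ℝ, ℝ) ∞ U) :
    ContMDiff (modelTM E) 𝓘(ℝ, ℝ) ∞ (hamiltonian g U) :=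
  (contMDiff_kinetic g).add (contMDiff_lift hU)

/-- The preferred chart of TM depends only on the base point, so the chart at `p` is also the one
centred at `⟨p.proj, w⟩`. -/
theorem extChartAt_TM_symm_self (p : TM E M) (w : E) :
    (extChartAt (modelTM E) p).symm (extChartAt 𝓘(ℝ, E) p.proj p.proj, w) = ⟨p.proj, w⟩ := by
  have h := (extChartAt (modelTM E) (⟨p.proj, w⟩ : TM E M)).left_inv (mem_extChartAt_source _)
  rw [extChartAt_TM_self] at h
  exact h

/-- Varying only the second coordinate of the chart moves the vector inside its fibre, so
derivatives along vertical vectors are ordinary derivatives on a vector space. -/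
theorem mvfderiv_vertical {F : Type*} [NormedAddCommGroup F] [NormedSpace ℝ F]
    {f : TM E M → F} {p : TM E M} (hf : MDifferentiableAt (modelTM E) 𝓘(ℝ, F) f p) (η : E) :
    mvfderiv (modelTM E) f p ((0, η) : E × E) =
      fderiv ℝ (fun w : E => f ⟨p.proj, w⟩) p.2 η := by
  have h := differentiableAt_chart hf
  refine (mvfderiv_eq_fderiv hf _).trans ?_
  rw [extChartAt_TM_self] at h ⊢
  have h4 : (fun w : E => f ⟨p.proj, w⟩) = (fun y => f ((extChartAt (modelTM E) p).symm y)) ∘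
      (fun w : E => (extChartAt 𝓘(ℝ, E) p.proj p.proj, w)) := by
    ext w
    exact congrArg f (extChartAt_TM_symm_self p w).symm
  have h2 : ∀ v : E, DifferentiableAt ℝ (fun y => f ((extChartAt (modelTM E) p).symm y))
        (extChartAt 𝓘(ℝ, E) p.proj p.proj, v) →
      fderiv ℝ (fun y => f ((extChartAt (modelTM E) p).symm y))
        (extChartAt 𝓘(ℝ, E) p.proj p.proj, v) (0, η) = fderiv ℝ (fun w : E => f ⟨p.proj, w⟩) v η := by
    intro v hv
    rw [h4, (hv.hasFDerivAt.comp v (hasFDerivAt_prodMk_right _ v)).fderiv]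
    rfl
  exact h2 p.2 h

theorem dTM_vertical {f : TM E M → ℝ} {p : TM E M} (hf : MDifferentiableAt (modelTM E) 𝓘(ℝ, ℝ) f p)
    (η : E) : dTM f p ((0, η) : E × E) = fderiv ℝ (fun w : E => f ⟨p.proj, w⟩) p.2 η :=
  mvfderiv_vertical hf η

theorem dTM_dot_vertical {f : M → ℝ} (hf : ContMDiff 𝓘(ℝ, E) 𝓘(ℝ, ℝ) ∞ f) (p : TM E M) (η : E) :
    dTM (dot f) p ((0, η) : E × E) = dM f p.proj η := by
  rw [dTM_vertical ((contMDiff_dot hf).mdifferentiable (by simp) p)]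
  let L : E →L[ℝ] ℝ := dM f p.proj
  have h : ∀ v : E, fderiv ℝ (fun w : E => L w) v η = L η := fun v => by
    rw [ContinuousLinearMap.fderiv]
  exact h p.2

theorem dTM_hamiltonian_vertical (g : PseudoMetric E M) {U : M → ℝ}
    (hU : ContMDiff 𝓘(ℝ, E) 𝓘(ℝ, ℝ) ∞ U) (p : TM E M) (η : E) :
    dTM (hamiltonian g U) p ((0, η) : E × E) = g.inner p.proj p.2 η := by
  rw [dTM_vertical ((contMDiff_hamiltonian g hU).mdifferentiable (by simp) p)]
  let G : E →L[ℝ] E →L[ℝ] ℝ := g.inner p.proj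
  have h : ∀ v : E, fderiv ℝ (fun w : E => (1 / 2) * G w w + U p.proj) v η = G v η := by
    intro v
    have h1 := ((G.hasFDerivAt.clm_apply (hasFDerivAt_id v)).const_mul (1/2)).add_const (U p.proj)
    have hs : G η v = G v η := g.symm p.proj η v
    have h2 := DFunLike.congr_fun h1.fderiv η
    refine h2.trans ?_
    simp [hs]
    ring
  exact h p.2

/-- The metric in the preferred chart at `a`, as a function with values in bilinear forms. -/
def localMetric (g : PseudoMetric E M) (a : M) (x : E) : E →L[ℝ] E →L[ℝ] ℝ :=
  ContinuousLinearMap.bilinearComp (E := E) (F := E) (G := ℝ) (E' := E) (F' := E)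
    (g.inner ((extChartAt 𝓘(ℝ, E) a).symm x))
    (mfderiv 𝓘(ℝ, E) 𝓘(ℝ, E) (extChartAt 𝓘(ℝ, E) a).symm x)
    (mfderiv 𝓘(ℝ, E) 𝓘(ℝ, E) (extChartAt 𝓘(ℝ, E) a).symm x)

/-- A field constant in the chart is the inverse chart of TM restricted to a slice x ↦ (x, v). Such
fields are the test vectors for the smoothness of `localMetric`. -/
theorem contMDiffOn_constField (a : M) (v : E) :
    ContMDiffOn 𝓘(ℝ, E) (modelTM E) ∞ (fun x : E => (⟨(extChartAt 𝓘(ℝ, E) a).symm x,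
      mfderiv 𝓘(ℝ, E) 𝓘(ℝ, E) (extChartAt 𝓘(ℝ, E) a).symm x v⟩ : TM E M))
      (extChartAt 𝓘(ℝ, E) a).target := by
  let p : TM E M := ⟨a, 0⟩
  have h1 := contMDiffOn_extChartAt_symm (I := modelTM E) (n := ∞) p
  have h2 : ContMDiff 𝓘(ℝ, E) 𝓘(ℝ, E × E) ∞ (fun x : E => (x, v)) :=
    (contDiff_id.prodMk contDiff_const).contMDiff
  have h3 : MapsTo (fun x : E => (x, v)) (extChartAt 𝓘(ℝ, E) a).target
      (extChartAt (modelTM E) p).target := by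
    intro x hx
    rw [extChartAt_TM_target]
    exact ⟨hx, mem_univ _⟩
  refine (h1.comp h2.contMDiffOn h3).congr ?_
  intro x hx
  exact (extChartAt_TM_symm p (y := (x, v)) hx).symm

theorem contDiffOn_localMetric [FiniteDimensional ℝ E] (g : PseudoMetric E M) (a : M) :
    ContDiffOn ℝ ∞ (localMetric g a) (extChartAt 𝓘(ℝ, E) a).target := by
  refine contDiffOn_clm_apply.2 fun v => contDiffOn_clm_apply.2 fun w => ?_
  have hs := contMDiffOn_extChartAt_symm (I := 𝓘(ℝ, E)) (n := ∞) a
  have h := ContMDiffOn.clm_bundle_apply₂ (F₁ := E) (F₂ := E) (F₃ := ℝ) (E₃ := fun _ : M => ℝ)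
    (b := (extChartAt 𝓘(ℝ, E) a).symm) (ψ := fun x => g.inner ((extChartAt 𝓘(ℝ, E) a).symm x))
    (g.contMDiff.comp_contMDiffOn hs) (contMDiffOn_constField a v) (contMDiffOn_constField a w)
  intro x hx
  have h2 := (contMDiffWithinAt_totalSpace.1 (h x hx)).2
  exact h2.contDiffWithinAt

theorem localMetric_self (g : PseudoMetric E M) (a : M) :
    localMetric g a (extChartAt 𝓘(ℝ, E) a a) = g.inner a := by
  have h1 := mfderivWithin_range_extChartAt_symm (I := 𝓘(ℝ, E)) (x := a)
  rw [modelWithCornersSelf_coe, range_id, mfderivWithin_univ] at h1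
  have h2 : ∀ b : M, b = a → (g.inner b : E →L[ℝ] E →L[ℝ] ℝ) = g.inner a := by
    rintro _ rfl; rfl
  have h3 := h2 _ (extChartAt_to_inv (I := 𝓘(ℝ, E)) a)
  ext v w
  have hv : ∀ v : E, mfderiv 𝓘(ℝ, E) 𝓘(ℝ, E) (extChartAt 𝓘(ℝ, E) a).symm
      (extChartAt 𝓘(ℝ, E) a a) v = v := fun v => DFunLike.congr_fun h1 v
  refine (congrArg₂ (fun v w : E => (g.inner ((extChartAt 𝓘(ℝ, E) a).symm
    (extChartAt 𝓘(ℝ, E) a a)) : E →L[ℝ] E →L[ℝ] ℝ) v w) (hv v) (hv w)).trans ?_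
  exact DFunLike.congr_fun (DFunLike.congr_fun h3 v) w

theorem chartRep_liouville (g : PseudoMetric E M) (p : TM E M) {y : E × E}
    (hy : y.1 ∈ (extChartAt 𝓘(ℝ, E) p.proj).target) (ξ : E × E) :
    chartRep (liouville g) p y ξ = localMetric g p.proj y.1 y.2 ξ.1 := by
  have hyt : y ∈ (extChartAt (modelTM E) p).target := by
    rw [extChartAt_TM_target]; exact ⟨hy, mem_univ _⟩
  have h1 := mfderiv_comp_apply y (contMDiff_proj.mdifferentiable (by simp) _)
    (mdifferentiableAt_extChartAt_symm (J := modelTM E) hyt) ξ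
  have hopen : ∀ᶠ z in nhds y, z ∈ (extChartAt (modelTM E) p).target :=
    (isOpen_extChartAt_target p).mem_nhds hyt
  have e : ((fun q : TM E M => q.proj) ∘ (extChartAt (modelTM E) p).symm) =ᶠ[nhds y]
      (extChartAt 𝓘(ℝ, E) p.proj).symm ∘ Prod.fst := by
    filter_upwards [hopen] with z hz
    rw [extChartAt_TM_target] at hz
    exact congrArg TotalSpace.proj (extChartAt_TM_symm p hz.1)
  have h2 := mfderiv_comp_apply (I := 𝓘(ℝ, E × E)) (I' := 𝓘(ℝ, E)) (I'' := 𝓘(ℝ, E)) (f := Prod.fst) y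
    (mdifferentiableAt_extChartAt_symm (J := 𝓘(ℝ, E)) hy)
    (differentiableAt_fst.mdifferentiableAt) ξ
  have h3 : mfderiv 𝓘(ℝ, E × E) 𝓘(ℝ, E) (Prod.fst : E × E → E) y ξ = ξ.1 := by
    rw [mfderiv_eq_fderiv, fderiv_fst]; rfl
  have h4 : (projDeriv ((extChartAt (modelTM E) p).symm y)
      (mfderiv 𝓘(ℝ, E × E) (modelTM E) (extChartAt (modelTM E) p).symm y ξ) : E) =
      mfderiv 𝓘(ℝ, E) 𝓘(ℝ, E) (extChartAt 𝓘(ℝ, E) p.proj).symm y.1 ξ.1 := by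
    refine h1.symm.trans ?_
    have h5 := DFunLike.congr_fun (e.mfderiv_eq (I := 𝓘(ℝ, E × E)) (I' := 𝓘(ℝ, E))) ξ
    exact h5.trans (h2.trans (congrArg _ h3))
  have h6 : ∀ (q q' : TM E M) (_ : q = q') (η : E),
      (g.inner q.proj : E →L[ℝ] E →L[ℝ] ℝ) q.2 η = (g.inner q'.proj : E →L[ℝ] E →L[ℝ] ℝ) q'.2 η := by
    rintro q _ rfl η; rfl
  refine (h6 _ _ (extChartAt_TM_symm p hy) _).trans ?_
  exact congrArg (fun t : E => (g.inner ((extChartAt 𝓘(ℝ, E) p.proj).symm y.1) :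
    E →L[ℝ] E →L[ℝ] ℝ) (mfderiv 𝓘(ℝ, E) 𝓘(ℝ, E) (extChartAt 𝓘(ℝ, E) p.proj).symm y.1 y.2) t) h4

theorem hasFDerivAt_chartRep_liouville [FiniteDimensional ℝ E] (g : PseudoMetric E M) (p : TM E M) :
    ∃ A : E →L[ℝ] E →L[ℝ] ℝ, ∃ B : E × E →L[ℝ] E × E →L[ℝ] ℝ,
      HasFDerivAt (chartRep (liouville g) p) B (extChartAt (modelTM E) p p) ∧
      ∀ X ξ : E × E, B X ξ = A X.1 ξ.1 + (g.inner p.proj : E →L[ℝ] E →L[ℝ] ℝ) X.2 ξ.1 := by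
  rw [extChartAt_TM_self]
  have hG := ((contDiffOn_localMetric g p.proj).contDiffAt
    (extChartAt_target_mem_nhds (I := 𝓘(ℝ, E)) p.proj)).differentiableAt (by simp)
  have e : ∀ v : E, chartRep (liouville g) p =ᶠ[nhds (extChartAt 𝓘(ℝ, E) p.proj p.proj, v)]
      (fun y : E × E => (localMetric g p.proj y.1 y.2).comp (ContinuousLinearMap.fst ℝ E E)) := by
    intro v
    have : ∀ᶠ y : E × E in nhds (extChartAt 𝓘(ℝ, E) p.proj p.proj, v),
        y.1 ∈ (extChartAt 𝓘(ℝ, E) p.proj).target :=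
      continuousAt_fst.eventually_mem (f := Prod.fst)
        (x := ((extChartAt 𝓘(ℝ, E) p.proj p.proj, v) : E × E))
        (extChartAt_target_mem_nhds (I := 𝓘(ℝ, E)) p.proj)
    filter_upwards [this] with y hy
    refine ContinuousLinearMap.ext fun ξ => ?_
    exact chartRep_liouville g p hy ξ
  obtain ⟨B, hB, hBX⟩ := hasFDerivAt_bilinear_comp_fst hG p.2
  -- `A` is the derivative of the metric with the velocity inserted in one slot. Later only its
  -- existence matters, since it acts on base components alone.
  refine ⟨(fderiv ℝ (localMetric g p.proj) (extChartAt 𝓘(ℝ, E) p.proj p.proj)).flip p.2, B,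
    hB.congr_of_eventuallyEq (e p.2), ?_⟩
  intro X ξ
  rw [hBX, localMetric_self g p.proj]
  rfl

theorem differentiableAt_chartRep_liouville [FiniteDimensional ℝ E] (g : PseudoMetric E M)
    (p : TM E M) :
    DifferentiableAt ℝ (chartRep (liouville g) p) (extChartAt (modelTM E) p p) := by
  obtain ⟨A, B, h, -⟩ := hasFDerivAt_chartRep_liouville g p
  exact h.differentiableAt

/-- The form `ω₂ = dθ` in the coordinates of the preferred chart. -/
theorem extD_liouville [FiniteDimensional ℝ E] (g : PseudoMetric E M) (p : TM E M) :
    ∃ A : E →L[ℝ] E →L[ℝ] ℝ, ∀ X ξ : E × E, extD (liouville g) p X ξ = A X.1 ξ.1 - A ξ.1 X.1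
      + (g.inner p.proj : E →L[ℝ] E →L[ℝ] ℝ) X.2 ξ.1
      - (g.inner p.proj : E →L[ℝ] E →L[ℝ] ℝ) ξ.2 X.1 := by
  obtain ⟨A, B, h, hB⟩ := hasFDerivAt_chartRep_liouville g p
  refine ⟨A, fun X ξ => ?_⟩
  refine (extD_eq_fderiv h.differentiableAt X ξ).trans ?_
  rw [h.fderiv]
  refine (congrArg₂ (· - ·) (hB X ξ) (hB ξ X)).trans ?_
  ring

end TangentBundleCoordinates

/-! ### Linear algebra in one tangent space of `TM` -/

section FiberAlgebra

variable {E : Type*} [NormedAddCommGroup E] [NormedSpace ℝ E]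

/-- The 2-form `ω₂` in a tangent space of `TM`, identified with `E × E` by a chart. -/
def symplecticForm (A G : E →L[ℝ] E →L[ℝ] ℝ) (X ξ : E × E) : ℝ :=
  A X.1 ξ.1 - A ξ.1 X.1 + G X.2 ξ.1 - G ξ.2 X.1

/-- The differential of `H / ẋ⁰` in terms of `dH` and `dẋ⁰`. -/
def quotientDiff (dH dy : E × E →L[ℝ] ℝ) (h y : ℝ) (ξ : E × E) : ℝ :=
  dH ξ / y - h / y ^ 2 * dy ξ

/-- The left-hand side of `i_X dθ̄ + (H / ẋ⁰) dẋ⁰ = 0`. -/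
def newtonBarForm (A G : E →L[ℝ] E →L[ℝ] ℝ) (dH dy : E × E →L[ℝ] ℝ) (k : E) (h y : ℝ)
    (X ξ : E × E) : ℝ :=
  symplecticForm A G X ξ - (quotientDiff dH dy h y X * G k ξ.1
    - quotientDiff dH dy h y ξ * G k X.1) + h / y * dy ξ

/-- The modified field in one tangent space. -/
def modifiedVector (G : E →L[ℝ] E →L[ℝ] ℝ) (dy : E × E →L[ℝ] ℝ) (k : E) (Z : E × E) : E × E :=
  Z - (dy Z / G k k) • ((0, k) : E × E)

variable {A G : E →L[ℝ] E →L[ℝ] ℝ} {dH dy : E × E →L[ℝ] ℝ} {k v : E} {h y : ℝ} {Z X : E × E}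

theorem symplecticForm_sub (X Y ξ : E × E) :
    symplecticForm A G (X - Y) ξ = symplecticForm A G X ξ - symplecticForm A G Y ξ := by
  simp [symplecticForm]; ring

theorem symplecticForm_vertical (c : ℝ) (k : E) (ξ : E × E) :
    symplecticForm A G (c • ((0, k) : E × E)) ξ = c * G k ξ.1 := by
  simp [symplecticForm]

theorem symplecticForm_self (X : E × E) : symplecticForm A G X X = 0 := by
  simp [symplecticForm]

/-- Vertical test vectors kill the base part; after that, horizontal ones kill the fibre part. -/
theorem eq_zero_of_symplecticForm (hs : ∀ v w, G v w = G w v)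
    (hn : ∀ v, (∀ w, G v w = 0) → v = 0)
    (h0 : ∀ ξ, symplecticForm A G X ξ = 0) : X = 0 := by
  have h1 : X.1 = 0 := hn _ fun w => by
    have := h0 (0, w)
    simp [symplecticForm] at this
    rw [hs, this]
  have h2 : X.2 = 0 := hn _ fun w => by
    have := h0 (w, 0)
    simpa [symplecticForm, h1] using this
  exact Prod.ext h1 h2

theorem modifiedVector_fst : (modifiedVector G dy k Z).1 = Z.1 := by
  simp [modifiedVector]

theorem dy_modifiedVector (hdy : ∀ η, dy (0, η) = G k η) (hk : G k k ≠ 0) :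
    dy (modifiedVector G dy k Z) = 0 := by
  simp only [modifiedVector, map_sub, map_smul, hdy, smul_eq_mul]
  field_simp
  ring

theorem symplecticForm_modifiedVector (ξ : E × E) :
    symplecticForm A G (modifiedVector G dy k Z) ξ
      = symplecticForm A G Z ξ - dy Z / G k k * G k ξ.1 := by
  rw [modifiedVector, symplecticForm_sub, symplecticForm_vertical]

/-- The vertical vector `(0, k)` represents dx⁰ through ω₂, so the congruence determines `X - Z` up
to a multiple of it. The condition `dy X = 0` then fixes the multiple, as `dy (0, k) = G k k ≠ 0`.
-/
theorem modification_iff (hs : ∀ v w, G v w = G w v) (hn : ∀ v, (∀ w, G v w = 0) → v = 0)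
    (hdy : ∀ η, dy (0, η) = G k η) (hk : G k k ≠ 0) :
    ((∃ c : ℝ, ∀ ξ, symplecticForm A G X ξ - symplecticForm A G Z ξ = c * G k ξ.1) ∧ dy X = 0)
      ↔ X = modifiedVector G dy k Z := by
  constructor
  · rintro ⟨⟨c, hc⟩, hX⟩
    have h1 : X - Z - c • ((0, k) : E × E) = 0 :=
      eq_zero_of_symplecticForm (A := A) hs hn fun ξ => by
        rw [symplecticForm_sub, symplecticForm_sub, symplecticForm_vertical, hc, sub_self]
    have h2 : X = Z + c • ((0, k) : E × E) := by
      rw [sub_sub, sub_eq_zero] at h1; exact h1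
    have h3 : dy Z + c * G k k = 0 := by
      rw [← hX, h2, map_add, map_smul, hdy, smul_eq_mul]
    have h4 : c = -(dy Z / G k k) := by
      field_simp
      linarith
    rw [h2, h4, modifiedVector, neg_smul, sub_eq_add_neg]
  · rintro rfl
    refine ⟨⟨-(dy Z / G k k), fun ξ => ?_⟩, dy_modifiedVector hdy hk⟩
    rw [symplecticForm_modifiedVector]
    ring

variable (hy : y = G k v) (hy0 : y ≠ 0) (hdy : ∀ η, dy (0, η) = G k η)
  (hdH : ∀ η, dH (0, η) = G v η) (hZv : Z.1 = v)
  (hZ : ∀ ξ, symplecticForm A G Z ξ + dH ξ = 0)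

include hy hy0 hdy hZv hZ in
theorem newtonBarForm_modifiedVector (hk : G k k ≠ 0) (ξ : E × E) :
    newtonBarForm A G dH dy k h y (modifiedVector G dy k Z) ξ = 0 := by
  set Y := modifiedVector G dy k Z with hY
  have h1 : Y.1 = v := by rw [hY, modifiedVector_fst, hZv]
  have h2 : dy Y = 0 := dy_modifiedVector hdy hk
  have h3 : ∀ ξ, symplecticForm A G Y ξ = -dH ξ - dy Z / G k k * G k ξ.1 := fun ξ => by
    rw [hY, symplecticForm_modifiedVector]
    linarith [hZ ξ]
  -- Contracting with `Y` itself kills ω₂ and yields the derivative of H along `Y`.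
  have h4 := h3 Y
  rw [symplecticForm_self, h1, ← hy] at h4
  have h5 : dH Y = - (dy Z / G k k * y) := by linarith
  simp only [newtonBarForm, quotientDiff, h3, h1, h2, h5, ← hy]
  generalize dy Z / G k k = c
  field_simp
  ring

include hy hy0 hdy hdH hZ in
theorem eq_modifiedVector_of_newtonBarForm (hs : ∀ v w, G v w = G w v)
    (hn : ∀ v, (∀ w, G v w = 0) → v = 0) (hk : G k k ≠ 0) (hh : h ≠ 0)
    (hX : ∀ ξ, newtonBarForm A G dH dy k h y X ξ = 0) : X = modifiedVector G dy k Z := by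
  -- On ξ = X every alternating term vanishes, leaving (H/ẋ⁰) X(ẋ⁰) = 0.
  have h1 : dy X = 0 := by
    have := hX X
    simp only [newtonBarForm, symplecticForm_self, sub_self, zero_add] at this
    exact (mul_eq_zero.1 this).resolve_left (div_ne_zero hh hy0)
  set c := G k X.1 / y with hc
  have hcy : G k X.1 = c * y := by rw [hc]; field_simp
  -- Vertical test vectors see only the base part of `X`; by nondegeneracy they express it through
  -- `v` and `k`. Pairing the result with `k` forces `c = 1`.
  have h2 : X.1 - c • v - (h / y * (1 - c)) • k = 0 := hn _ fun η => by
    have := hX (0, η)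
    simp only [newtonBarForm, symplecticForm, quotientDiff, hdH, hdy, hcy, map_zero,
      zero_apply] at this
    rw [hs η X.1] at this
    simp only [map_sub, map_smul, sub_apply, smul_apply, smul_eq_mul]
    field_simp at this ⊢
    refine mul_left_cancel₀ hy0 ?_
    linarith
  have h3 : c = 1 := by
    have := congrArg (G k) h2
    simp only [map_sub, map_smul, smul_eq_mul, map_zero, hcy, ← hy, sub_self, zero_sub] at this
    have h4 : h / y * (1 - c) = 0 := by
      rcases mul_eq_zero.1 (neg_eq_zero.1 this) with h4 | h4
      · exact h4
      · exact absurd h4 hk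
    have h5 := (mul_eq_zero.1 h4).resolve_left (div_ne_zero hh hy0)
    linarith
  refine (modification_iff (A := A) hs hn hdy hk).1 ⟨⟨quotientDiff dH dy h y X, fun ξ => ?_⟩, h1⟩
  have h6 := hX ξ
  have h7 := hZ ξ
  rw [newtonBarForm, hcy, h3, one_mul] at h6
  -- This is ẋ⁰ d(H/ẋ⁰) + (H/ẋ⁰) dẋ⁰ = dH, which turns the barred equation back into the congruence
  -- mod dx⁰.
  have h8 : quotientDiff dH dy h y ξ * y + h / y * dy ξ = 0 + dH ξ := by
    rw [quotientDiff]; field_simp; ring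
  linarith

-- Vertical test vectors are not available here, but `L v` and the modified vector have the same
-- base part. Subtracting their equations gives a relation for the vertical difference `η` alone: it
-- is a multiple `d • k`, and the definition of `d` leaves h d G(k, k) = 0.
include hy hy0 hdy hdH hZv hZ in
theorem eq_modifiedVector_of_newtonBarForm_section (hs : ∀ v w, G v w = G w v)
    (hn : ∀ v, (∀ w, G v w = 0) → v = 0)
    (hk : G k k ≠ 0) (hh : h ≠ 0) {L : E → E × E} (hL : ∀ w, (L w).1 = w)
    (hX : ∀ w, newtonBarForm A G dH dy k h y (L v) (L w) = 0) :
    L v = modifiedVector G dy k Z := by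
  have hB := newtonBarForm_modifiedVector (h := h) hy hy0 hdy hZv hZ hk
  set Y := modifiedVector G dy k Z with hY
  have h1 : Y.1 = v := by rw [hY, modifiedVector_fst, hZv]
  obtain ⟨η, hη⟩ : ∃ η, L v = Y + (0, η) := ⟨(L v).2 - Y.2, by ext <;> simp [hL, h1]⟩
  set d := G v η / y - h / y ^ 2 * G k η with hd
  have h2 : η - d • k = 0 := hn _ fun w => by
    have e1 := hX w
    have e2 := hB (L w)
    have e3 : quotientDiff dH dy h y (L v) = quotientDiff dH dy h y Y + d := by
      simp only [quotientDiff, hη, map_add, hdH, hdy, hd]; ring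
    have e4 : symplecticForm A G (L v) (L w) = symplecticForm A G Y (L w) + G η w := by
      rw [hη]; simp [symplecticForm, hL]; ring
    rw [newtonBarForm, e3, e4, hL, hL] at e1
    rw [newtonBarForm, h1, hL] at e2
    simp only [map_sub, map_smul, sub_apply, smul_apply, smul_eq_mul]
    linarith
  have h3 : η = d • k := sub_eq_zero.1 h2
  have h4 : d = 0 := by
    have h5 : d = d * y / y - h / y ^ 2 * (d * G k k) := by
      conv_lhs => rw [hd, h3, map_smul, map_smul, hs v k, ← hy, smul_eq_mul, smul_eq_mul]
    rw [mul_div_cancel_right₀ _ hy0] at h5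
    have h6 : h / y ^ 2 * (d * G k k) = 0 := by linarith
    have h7 := (mul_eq_zero.1 h6).resolve_left (div_ne_zero hh (pow_ne_zero 2 hy0))
    exact (mul_eq_zero.1 h7).resolve_right hk
  rw [hη, h3, h4]
  simp

end FiberAlgebra

/-! ### From the linear algebra to pointwise statements on TM. -/

section Modification

variable {E : Type*} [NormedAddCommGroup E] [NormedSpace ℝ E] [FiniteDimensional ℝ E]
  {M : Type*} [TopologicalSpace M] [ChartedSpace E M] [IsManifold 𝓘(ℝ, E) ∞ M]
  {g : PseudoMetric E M} {U x0 : M → ℝ} {D : FieldTM E M}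

/-- The metric at `a`, on the model space. -/
def modelInner (g : PseudoMetric E M) (a : M) : E →L[ℝ] E →L[ℝ] ℝ := g.inner a

/-- The differential of a function on `TM`, on the model space. -/
def modelD (f : TM E M → ℝ) (p : TM E M) : E × E →L[ℝ] ℝ := dTM f p

/-- The gradient, as a vector of the model space. -/
def modelGrad (g : PseudoMetric E M) (f : M → ℝ) (a : M) : E := grad g f a

/-- The modification of the field `D` by the time constraint `ẋ⁰ = const`. -/
def modifiedField (g : PseudoMetric E M) (x0 : M → ℝ) (D : FieldTM E M) : FieldTM E M := fun p =>
  modifiedVector (modelInner g p.proj) (modelD (dot x0) p) (modelGrad g x0 p.proj) (D p)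

omit [FiniteDimensional ℝ E] in
theorem modelInner_symm (g : PseudoMetric E M) (a : M) (v w : E) :
    modelInner g a v w = modelInner g a w v := g.symm a v w

omit [FiniteDimensional ℝ E] in
theorem modelInner_nondegenerate (g : PseudoMetric E M) (a : M) (v : E)
    (hv : ∀ w, modelInner g a v w = 0) : v = 0 := g.nondegenerate a v hv

theorem modelInner_modelGrad (g : PseudoMetric E M) (f : M → ℝ) (a : M) (w : E) :
    modelInner g a (modelGrad g f a) w = dM f a w := inner_grad g f a w

theorem dot_eq_modelInner (g : PseudoMetric E M) (x0 : M → ℝ) (p : TM E M) :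
    dot x0 p = modelInner g p.proj (modelGrad g x0 p.proj) p.2 :=
  (inner_grad g x0 p.proj p.2).symm

theorem modelD_dot_vertical (g : PseudoMetric E M) (hx0 : ContMDiff 𝓘(ℝ, E) 𝓘(ℝ, ℝ) ∞ x0)
    (p : TM E M) (η : E) :
    modelD (dot x0) p (0, η) = modelInner g p.proj (modelGrad g x0 p.proj) η :=
  (dTM_dot_vertical hx0 p η).trans (inner_grad g x0 p.proj η).symm

theorem dTM_lift_eq_modelInner (g : PseudoMetric E M) (hx0 : ContMDiff 𝓘(ℝ, E) 𝓘(ℝ, ℝ) ∞ x0)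
    (p : TM E M) (ξ : E × E) :
    dTM (lift x0) p ξ = modelInner g p.proj (modelGrad g x0 p.proj) ξ.1 :=
  (dTM_lift hx0 p ξ).trans (inner_grad g x0 p.proj ξ.1).symm

theorem exists_extD_liouville (g : PseudoMetric E M) (p : TM E M) :
    ∃ A : E →L[ℝ] E →L[ℝ] ℝ, ∀ X ξ : E × E,
      extD (liouville g) p X ξ = symplecticForm A (modelInner g p.proj) X ξ :=
  extD_liouville g p

omit [FiniteDimensional ℝ E] in
theorem dTM_hamiltonian (g : PseudoMetric E M) (hU : ContMDiff 𝓘(ℝ, E) 𝓘(ℝ, ℝ) ∞ U)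
    (p : TM E M) (ξ : TangentSpace (modelTM E) p) :
    dTM (hamiltonian g U) p ξ = dTM (kinetic g) p ξ + dTM (lift U) p ξ := by
  have := mvfderiv_add ((contMDiff_kinetic g).mdifferentiable (by simp) p)
    ((contMDiff_lift hU).mdifferentiable (by simp) p)
  exact DFunLike.congr_fun this ξ

omit [FiniteDimensional ℝ E] in
theorem IsMotionField.extD_add_dTM (hD : IsMotionField g U D)
    (hU : ContMDiff 𝓘(ℝ, E) 𝓘(ℝ, ℝ) ∞ U) (p : TM E M) (ξ : TangentSpace (modelTM E) p) :
    extD (liouville g) p (D p) ξ + dTM (hamiltonian g U) p ξ = 0 := by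
  have := hD.newton p ξ
  rw [dTM_hamiltonian g hU, ← this, forceForm]
  ring

omit [FiniteDimensional ℝ E] in
theorem IsMotionField.fst_eq (hD : IsMotionField g U D) (p : TM E M) :
    (D p : E × E).1 = p.2 :=
  (projDeriv_apply p (D p)).symm.trans (hD.secondOrder p)

theorem IsMotionField.modifiedField_fst (hD : IsMotionField g U D) (p : TM E M) :
    (modifiedField g x0 D p : E × E).1 = p.2 :=
  modifiedVector_fst.trans (hD.fst_eq p)

omit [FiniteDimensional ℝ E] in
theorem mdifferentiableAt_hamiltonian_div_dot (g : PseudoMetric E M)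
    (hU : ContMDiff 𝓘(ℝ, E) 𝓘(ℝ, ℝ) ∞ U) (hx0 : ContMDiff 𝓘(ℝ, E) 𝓘(ℝ, ℝ) ∞ x0) {p : TM E M}
    (hp : dot x0 p ≠ 0) :
    MDifferentiableAt (modelTM E) 𝓘(ℝ, ℝ) (fun q => hamiltonian g U q / dot x0 q) p :=
  ((contMDiff_hamiltonian g hU p).div₀ (contMDiff_dot hx0 p) hp).mdifferentiableAt (by simp)

theorem fderiv_div_apply {F : Type*} [NormedAddCommGroup F] [NormedSpace ℝ F] {a b : F → ℝ} {x : F}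
    (ha : DifferentiableAt ℝ a x) (hb : DifferentiableAt ℝ b x) (hx : b x ≠ 0) (v : F) :
    fderiv ℝ (fun y => a y / b y) x v = fderiv ℝ a x v / b x - a x / b x ^ 2 * fderiv ℝ b x v := by
  have h1 := ha.hasFDerivAt.mul ((hasDerivAt_inv hx).comp_hasFDerivAt x hb.hasFDerivAt)
  have h2 : HasFDerivAt (fun y => a y / b y) _ x := h1
  rw [h2.fderiv]
  simp
  field_simp
  ring

omit [FiniteDimensional ℝ E] in
theorem dTM_hamiltonian_div_dot (g : PseudoMetric E M)
    (hU : ContMDiff 𝓘(ℝ, E) 𝓘(ℝ, ℝ) ∞ U) (hx0 : ContMDiff 𝓘(ℝ, E) 𝓘(ℝ, ℝ) ∞ x0) {p : TM E M}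
    (hp : dot x0 p ≠ 0) (ξ : E × E) :
    mvfderiv (modelTM E) (fun q => hamiltonian g U q / dot x0 q) p ξ =
      quotientDiff (modelD (hamiltonian g U) p) (modelD (dot x0) p) (hamiltonian g U p)
        (dot x0 p) ξ := by
  have hH := (contMDiff_hamiltonian g hU).mdifferentiable (by simp) p
  have hd := (contMDiff_dot hx0).mdifferentiable (by simp) p
  have h1 : modelD (hamiltonian g U) p ξ = _ := mvfderiv_eq_fderiv hH ξ
  have h2 : modelD (dot x0) p ξ = _ := mvfderiv_eq_fderiv hd ξ
  refine (mvfderiv_eq_fderiv (mdifferentiableAt_hamiltonian_div_dot g hU hx0 hp) ξ).trans ?_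
  have h3 := fderiv_div_apply (differentiableAt_chart hH) (differentiableAt_chart hd)
    (by rwa [extChartAt_to_inv]) ξ
  rw [extChartAt_to_inv] at h3
  rw [quotientDiff, h1, h2]
  exact h3

/-- The bridge to linear algebra: dθ̄ = ω₂ − d(H/ẋ⁰) ∧ dx⁰, with the quotient rule for H/ẋ⁰ and dx⁰
represented by the gradient. -/
theorem newtonBar_eq (hU : ContMDiff 𝓘(ℝ, E) 𝓘(ℝ, ℝ) ∞ U)
    (hx0 : ContMDiff 𝓘(ℝ, E) 𝓘(ℝ, ℝ) ∞ x0) {p : TM E M} (hp : dot x0 p ≠ 0)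
    {A : E →L[ℝ] E →L[ℝ] ℝ}
    (hA : ∀ X ξ : E × E, extD (liouville g) p X ξ = symplecticForm A (modelInner g p.proj) X ξ)
    (X ξ : E × E) :
    extD (liouvilleBar g U x0) p X ξ + hamiltonian g U p / dot x0 p * dTM (dot x0) p ξ =
      newtonBarForm A (modelInner g p.proj) (modelD (hamiltonian g U) p) (modelD (dot x0) p)
        (modelGrad g x0 p.proj) (hamiltonian g U p) (dot x0 p) X ξ := by
  have h1 := extD_sub_smul (differentiableAt_chartRep_liouville g p)
    (mdifferentiableAt_hamiltonian_div_dot g hU hx0 hp) (contMDiff_lift hx0) X ξ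
  have h2 : extD (liouvilleBar g U x0) p X ξ = _ := h1
  have h3 : mvfderiv (modelTM E) (lift x0 : TM E M → ℝ) p X = _ := dTM_lift_eq_modelInner g hx0 p X
  have h4 : mvfderiv (modelTM E) (lift x0 : TM E M → ℝ) p ξ = _ := dTM_lift_eq_modelInner g hx0 p ξ
  rw [newtonBarForm, ← hA, ← dTM_hamiltonian_div_dot g hU hx0 hp X,
    ← dTM_hamiltonian_div_dot g hU hx0 hp ξ, h2, h3, h4]
  rfl

theorem isTimeModification_at_iff (hx0 : ContMDiff 𝓘(ℝ, E) 𝓘(ℝ, ℝ) ∞ x0) {p : TM E M}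
    (hp : p ∈ regularDomain g x0) (X : TangentSpace (modelTM E) p) :
    ((∃ c : ℝ, ∀ ξ : TangentSpace (modelTM E) p,
      extD (liouville g) p X ξ + dTM (kinetic g) p ξ + forceForm g D p ξ
        = c * dTM (lift x0) p ξ) ∧ dTM (dot x0) p X = 0) ↔ X = modifiedField g x0 D p := by
  obtain ⟨A, hA⟩ := exists_extD_liouville g p
  have h1 := modification_iff (A := A) (X := X) (Z := D p) (modelInner_symm g p.proj)
    (modelInner_nondegenerate g p.proj) (modelD_dot_vertical g hx0 p) hp.2
  refine Iff.trans ?_ h1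
  refine and_congr (exists_congr fun c => forall_congr' fun ξ => ?_) Iff.rfl
  have h2 := hA X ξ
  have h3 := hA (D p) ξ
  have h4 := dTM_lift_eq_modelInner g hx0 p ξ
  rw [← h2, ← h3, ← h4, forceForm]
  -- The force form contains −dT, so dT cancels and only i_X ω₂ − i_D ω₂ remains.
  have : ∀ a b d e : ℝ, a + b + -(d + b) = e ↔ a - d = e := fun a b d e => by
    constructor <;> intro h <;> linarith
  exact this _ _ _ _

variable (hU : ContMDiff 𝓘(ℝ, E) 𝓘(ℝ, ℝ) ∞ U) (hx0 : ContMDiff 𝓘(ℝ, E) 𝓘(ℝ, ℝ) ∞ x0)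
  (hD : IsMotionField g U D)

include hU hx0 hD in
theorem newtonBar_modifiedField {p : TM E M} (hp : p ∈ regularDomain g x0)
    (ξ : TangentSpace (modelTM E) p) :
    extD (liouvilleBar g U x0) p (modifiedField g x0 D p) ξ
      + hamiltonian g U p / dot x0 p * dTM (dot x0) p ξ = 0 := by
  obtain ⟨A, hA⟩ := exists_extD_liouville g p
  refine (newtonBar_eq hU hx0 hp.1 hA _ ξ).trans ?_
  exact newtonBarForm_modifiedVector (dot_eq_modelInner g x0 p) hp.1
    (modelD_dot_vertical g hx0 p) (hD.fst_eq p)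
    (fun ξ => (congrArg (· + _) (hA (D p) ξ).symm).trans (hD.extD_add_dTM hU p ξ)) hp.2 ξ

include hU hx0 hD in
theorem eq_modifiedField_of_newtonBar {p : TM E M} (hp : p ∈ regularDomain g x0)
    (hH : hamiltonian g U p ≠ 0) {X : TangentSpace (modelTM E) p}
    (hX : ∀ ξ : TangentSpace (modelTM E) p, extD (liouvilleBar g U x0) p X ξ
      + hamiltonian g U p / dot x0 p * dTM (dot x0) p ξ = 0) : X = modifiedField g x0 D p := by
  obtain ⟨A, hA⟩ := exists_extD_liouville g p
  exact eq_modifiedVector_of_newtonBarForm (dot_eq_modelInner g x0 p) hp.1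
    (modelD_dot_vertical g hx0 p) (dTM_hamiltonian_vertical g hU p)
    (fun ξ => (congrArg (· + _) (hA (D p) ξ).symm).trans (hD.extD_add_dTM hU p ξ))
    (modelInner_symm g p.proj) (modelInner_nondegenerate g p.proj) hp.2 hH
    fun ξ => (newtonBar_eq hU hx0 hp.1 hA X ξ).symm.trans (hX ξ)

include hU hx0 hD in
theorem eq_modifiedField_of_newtonBar_section {p : TM E M} (hp : p ∈ regularDomain g x0)
    (hH : hamiltonian g U p ≠ 0) {L : TangentSpace 𝓘(ℝ, E) p.proj → TangentSpace (modelTM E) p}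
    (hL : ∀ w, projDeriv p (L w) = w)
    (hX : ∀ w, extD (liouvilleBar g U x0) p (L p.2) (L w)
      + hamiltonian g U p / dot x0 p * dTM (dot x0) p (L w) = 0) :
    L p.2 = modifiedField g x0 D p := by
  obtain ⟨A, hA⟩ := exists_extD_liouville g p
  exact eq_modifiedVector_of_newtonBarForm_section (dot_eq_modelInner g x0 p) hp.1
    (modelD_dot_vertical g hx0 p) (dTM_hamiltonian_vertical g hU p) (hD.fst_eq p)
    (fun ξ => (congrArg (· + _) (hA (D p) ξ).symm).trans (hD.extD_add_dTM hU p ξ))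
    (modelInner_symm g p.proj) (modelInner_nondegenerate g p.proj) hp.2 hH
    (L := L) (fun w => (projDeriv_apply p (L w)).symm.trans (hL w))
    fun w => (newtonBar_eq hU hx0 hp.1 hA (L p.2) (L w)).symm.trans (hX w)

end Modification

/-! ### Smoothness of vector fields in a chart, and identity by continuity. -/

section General

variable {F : Type*} [NormedAddCommGroup F] [NormedSpace ℝ F]
  {K : Type*} [TopologicalSpace K] {J : ModelWithCorners ℝ F K}
  {N : Type*} [TopologicalSpace N] [ChartedSpace K N] [IsManifold J 1 N]

/-- The trivialization of the tangent bundle at `p₀` is the derivative of the chart at `p₀`, so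
smoothness is that of the component function in this one chart. -/
theorem contMDiffAt_field_iff (X : (p : N) → TangentSpace J p) (p₀ : N) :
    ContMDiffAt J J.tangent ∞ (fun p => (⟨p, X p⟩ : TangentBundle J N)) p₀ ↔
      ContMDiffAt J 𝓘(ℝ, F) ∞ (fun q => (mfderiv J 𝓘(ℝ, F) (extChartAt J p₀) q (X q) : F)) p₀ := by
  refine (contMDiffAt_section (IB := J) (s := X) p₀).trans ?_
  have e : (fun q => (trivializationAt F (TangentSpace J) p₀ ⟨q, X q⟩).2) =ᶠ[nhds p₀]
      (fun q => (mfderiv J 𝓘(ℝ, F) (extChartAt J p₀) q (X q) : F)) := by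
    filter_upwards [(chartAt K p₀).open_source.mem_nhds (mem_chart_source K p₀)] with q hq
    have h := DFunLike.congr_fun (TangentBundle.continuousLinearMapAt_trivializationAt (I := J) hq)
      (X q)
    refine Eq.trans ?_ h
    rw [Bundle.Trivialization.continuousLinearMapAt_apply,
      Bundle.Trivialization.linearMapAt_apply, if_pos]
    exact hq
  exact ⟨fun h => h.congr_of_eventuallyEq e.symm, fun h => h.congr_of_eventuallyEq e⟩

/-- Two continuous maps to a fibre bundle over the same base map that agree on a set agree at the
points of its closure, even if the base is not Hausdorff. -/
theorem eq_of_frequently_eq_bundle {T B F : Type*} [TopologicalSpace T] [TopologicalSpace B]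
    [TopologicalSpace F] [T2Space F] {V : B → Type*} [TopologicalSpace (TotalSpace F V)]
    [∀ b, TopologicalSpace (V b)] [FiberBundle F V] {f f' : T → TotalSpace F V} {t : T}
    (hf : ContinuousAt f t) (hf' : ContinuousAt f' t) (hp : (f t).proj = (f' t).proj)
    (h : ∃ᶠ s in nhds t, f s = f' s) : f t = f' t := by
  set e := trivializationAt F V (f t).proj with he
  have h1 : f t ∈ e.source := by
    rw [e.mem_source]; exact mem_baseSet_trivializationAt F V _
  have h2 : f' t ∈ e.source := by
    rw [e.mem_source, ← hp]; exact mem_baseSet_trivializationAt F V _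
  have c1 : ContinuousAt (fun s => (e (f s)).2) t :=
    ((e.continuousAt h1).comp hf).snd
  have c2 : ContinuousAt (fun s => (e (f' s)).2) t :=
    ((e.continuousAt h2).comp hf').snd
  have h3 : (e (f t)).2 = (e (f' t)).2 :=
    tendsto_nhds_unique_of_frequently_eq c1 c2 (h.mono fun s hs => by rw [hs])
  refine e.injOn h1 h2 (Prod.ext ?_ h3)
  change (e (f t)).1 = (e (f' t)).1
  rw [e.coe_fst h1, e.coe_fst h2, hp]

end General

/-! ### Smoothness of the modified field, and accumulation of points with H ≠ 0. -/

section Smoothness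

variable {E : Type*} [NormedAddCommGroup E] [NormedSpace ℝ E] [FiniteDimensional ℝ E]
  {M : Type*} [TopologicalSpace M] [ChartedSpace E M] [IsManifold 𝓘(ℝ, E) ∞ M]
  {g : PseudoMetric E M} {U x0 : M → ℝ} {D : FieldTM E M}

theorem exists_equiv_modelInner (g : PseudoMetric E M) (a : M) :
    ∃ e : E ≃L[ℝ] (E →L[ℝ] ℝ), (e : E →L[ℝ] E →L[ℝ] ℝ) = modelInner g a := by
  have hinj : Function.Injective (modelInner g a).toLinearMap := by
    rw [← LinearMap.ker_eq_bot, LinearMap.ker_eq_bot']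
    exact fun v hv => modelInner_nondegenerate g a v fun w => DFunLike.congr_fun hv w
  have hdim : Module.finrank ℝ E = Module.finrank ℝ (E →L[ℝ] ℝ) := by
    rw [← (LinearMap.toContinuousLinearMap (𝕜 := ℝ) (E := E) (F' := ℝ)).finrank_eq]
    exact (Subspace.dual_finrank_eq (K := ℝ) (V := E)).symm
  refine ⟨(LinearEquiv.ofInjectiveOfFinrankEq _ hinj hdim).toContinuousLinearEquiv, ?_⟩
  ext v w
  rfl

omit [FiniteDimensional ℝ E] in
theorem localMetric_apply (g : PseudoMetric E M) {a b : M}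
    (hb : b ∈ (extChartAt 𝓘(ℝ, E) a).source) (v : TangentSpace 𝓘(ℝ, E) b) (w : E) :
    localMetric g a (extChartAt 𝓘(ℝ, E) a b)
      (mfderiv 𝓘(ℝ, E) 𝓘(ℝ, E) (extChartAt 𝓘(ℝ, E) a) b v) w =
    g.inner b v (mfderiv 𝓘(ℝ, E) 𝓘(ℝ, E) (extChartAt 𝓘(ℝ, E) a).symm
      (extChartAt 𝓘(ℝ, E) a b) w) := by
  have h5 := mfderivWithin_extChartAt_symm_comp_mfderiv_extChartAt' (I := 𝓘(ℝ, E)) hb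
  rw [modelWithCornersSelf_coe, range_id, mfderivWithin_univ] at h5
  have h6 : mfderiv 𝓘(ℝ, E) 𝓘(ℝ, E) (extChartAt 𝓘(ℝ, E) a).symm (extChartAt 𝓘(ℝ, E) a b)
      (mfderiv 𝓘(ℝ, E) 𝓘(ℝ, E) (extChartAt 𝓘(ℝ, E) a) b v) = v := DFunLike.congr_fun h5 v
  have h2 : ∀ b' : M, b' = b → ∀ η : E, (g.inner b' : E →L[ℝ] E →L[ℝ] ℝ) v η =
      (g.inner b : E →L[ℝ] E →L[ℝ] ℝ) v η := by
    rintro _ rfl _; rfl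
  refine Eq.trans ?_ (h2 _ ((extChartAt 𝓘(ℝ, E) a).left_inv hb) _)
  exact congrArg (fun t : E => (g.inner ((extChartAt 𝓘(ℝ, E) a).symm (extChartAt 𝓘(ℝ, E) a b)) :
    E →L[ℝ] E →L[ℝ] ℝ) t (mfderiv 𝓘(ℝ, E) 𝓘(ℝ, E) (extChartAt 𝓘(ℝ, E) a).symm
      (extChartAt 𝓘(ℝ, E) a b) w)) h6

/-- In a chart the gradient is the inverse of the metric applied to the derivative of x⁰, and
inversion of operators is smooth at an invertible one. -/
theorem contMDiff_grad (g : PseudoMetric E M) (hx0 : ContMDiff 𝓘(ℝ, E) 𝓘(ℝ, ℝ) ∞ x0) :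
    ContMDiff 𝓘(ℝ, E) (modelTM E) ∞ (fun a => (⟨a, grad g x0 a⟩ : TM E M)) := by
  intro a
  refine (contMDiffAt_field_iff (J := 𝓘(ℝ, E)) (grad g x0) a).2 ?_
  set φ := extChartAt 𝓘(ℝ, E) a with hφ
  have hφs : ContMDiffAt 𝓘(ℝ, E) 𝓘(ℝ, E) ∞ φ a := contMDiffAt_extChartAt
  have hG : ContDiffAt ℝ ∞ (localMetric g a) (φ a) :=
    (contDiffOn_localMetric g a).contDiffAt (extChartAt_target_mem_nhds (I := 𝓘(ℝ, E)) a)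
  have hl : ContDiffAt ℝ ∞ (fderiv ℝ (fun z => x0 (φ.symm z))) (φ a) := by
    have hs : ContDiffAt ℝ ∞ (fun z => x0 (φ.symm z)) (φ a) := by
      have := contMDiffOn_extChartAt_symm (I := 𝓘(ℝ, E)) (n := ∞) a
      exact ((hx0.comp_contMDiffOn this).contMDiffAt
        (extChartAt_target_mem_nhds (I := 𝓘(ℝ, E)) a)).contDiffAt
    exact hs.fderiv_right (m := ∞) (by simp)
  obtain ⟨e, he⟩ := exists_equiv_modelInner g a
  have hGa : localMetric g a (φ a) = e := (localMetric_self g a).trans he.symm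
  have hinv : ContDiffAt ℝ ∞ (fun x => (localMetric g a x).inverse
      (fderiv ℝ (fun z => x0 (φ.symm z)) x)) (φ a) := by
    refine ContDiffAt.clm_apply ?_ hl
    refine ContDiffAt.comp (g := ContinuousLinearMap.inverse) (φ a) ?_ hG
    rw [hGa]
    exact contDiffAt_map_inverse e
  have h1 : ContMDiffAt 𝓘(ℝ, E) 𝓘(ℝ, E) ∞ (fun b => (localMetric g a (φ b)).inverse
      (fderiv ℝ (fun z => x0 (φ.symm z)) (φ b))) a :=
    ContMDiffAt.comp (g := fun x => (localMetric g a x).inverse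
      (fderiv ℝ (fun z => x0 (φ.symm z)) x)) a hinv.contMDiffAt hφs
  refine h1.congr_of_eventuallyEq ?_
  -- Invertibility is an open condition; near `a`, `inverse` is therefore a true inverse and not its
  -- default value.
  have hopen : ∀ᶠ b in nhds a, localMetric g a (φ b) ∈
      range ((↑) : (E ≃L[ℝ] (E →L[ℝ] ℝ)) → E →L[ℝ] E →L[ℝ] ℝ) := by
    have hc : ContinuousAt (fun b => localMetric g a (φ b)) a :=
      ContinuousAt.comp (g := localMetric g a) hG.continuousAt hφs.continuousAt
    refine hc.eventually_mem ?_
    rw [hGa]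
    exact ContinuousLinearEquiv.nhds e
  filter_upwards [hopen, extChartAt_source_mem_nhds (I := 𝓘(ℝ, E)) a] with b hb hbs
  obtain ⟨e', he'⟩ := hb
  rw [← he', ContinuousLinearMap.inverse_equiv]
  refine (ContinuousLinearEquiv.eq_symm_apply e').2 ?_
  refine ContinuousLinearMap.ext fun w => ?_
  have h2 := localMetric_apply g hbs (grad g x0 b) w
  have h6 : ∀ c : E, e' c w = localMetric g a (φ b) c w := fun c => by rw [← he']; rfl
  refine (h6 _).trans ((h2.trans (inner_grad g x0 b _)).trans ?_)
  have h3 := chartRep_mvfderiv (J := 𝓘(ℝ, E)) (p := a) (hx0.mdifferentiable (by simp))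
    ((extChartAt 𝓘(ℝ, E) a).map_source hbs)
  have h4 := DFunLike.congr_fun h3 w
  refine Eq.trans ?_ h4
  have h5 : ∀ b' : M, b' = b → ∀ η : E, (dM x0 b : E → ℝ) η = (dM x0 b' : E → ℝ) η := by
    rintro _ rfl _; rfl
  exact h5 _ ((extChartAt 𝓘(ℝ, E) a).left_inv hbs) _

-- The chart of TM is linear on each fibre, namely the derivative of the base chart, so it carries
-- vertical lifts to vertical lifts. This reduces the smoothness of the lifted gradient to that of
-- the gradient.
omit [FiniteDimensional ℝ E] in
theorem mfderiv_extChartAt_TM_vertical {p q : TM E M}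
    (hq : q.proj ∈ (extChartAt 𝓘(ℝ, E) p.proj).source) (η : E) :
    mfderiv (modelTM E) 𝓘(ℝ, E × E) (extChartAt (modelTM E) p) q ((0, η) : E × E) =
      ((0, mfderiv 𝓘(ℝ, E) 𝓘(ℝ, E) (extChartAt 𝓘(ℝ, E) p.proj) q.proj η) : E × E) := by
  have hq' : q ∈ (chartAt (ModelProd E E) p).source := by
    rw [TangentBundle.mem_chart_source_iff]
    simpa using hq
  refine (mvfderiv_vertical (mdifferentiableAt_extChartAt (I := modelTM E) hq') η).trans ?_
  let L : E →L[ℝ] E := mfderiv 𝓘(ℝ, E) 𝓘(ℝ, E) (extChartAt 𝓘(ℝ, E) p.proj) q.proj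
  have e : (fun w : E => extChartAt (modelTM E) p ⟨q.proj, w⟩) =
      fun w : E => (extChartAt 𝓘(ℝ, E) p.proj q.proj, L w) := by
    funext w
    exact extChartAt_TM_apply p ⟨q.proj, w⟩ hq
  have h : ∀ v : E, fderiv ℝ (fun w : E => (extChartAt 𝓘(ℝ, E) p.proj q.proj, L w)) v η
      = (0, L η) := fun v => by
    rw [((hasFDerivAt_const _ v).prodMk L.hasFDerivAt).fderiv]
    rfl
  rw [e]
  exact h q.2

theorem contMDiffAt_verticalGrad (g : PseudoMetric E M) (hx0 : ContMDiff 𝓘(ℝ, E) 𝓘(ℝ, ℝ) ∞ x0)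
    (p : TM E M) :
    ContMDiffAt (modelTM E) 𝓘(ℝ, E × E) ∞ (fun q => (mfderiv (modelTM E) 𝓘(ℝ, E × E)
      (extChartAt (modelTM E) p) q ((0, modelGrad g x0 q.proj) : E × E) : E × E)) p := by
  have h1 := (contMDiffAt_field_iff (J := 𝓘(ℝ, E)) (grad g x0) p.proj).1
    (contMDiff_grad g hx0 p.proj)
  have h2 := ContMDiffAt.comp (x := p) (f := fun q : TM E M => q.proj) h1 (contMDiff_proj p)
  have h3 : ContMDiffAt (modelTM E) 𝓘(ℝ, E × E) ∞ (fun q : TM E M => ((0 : E), _)) p :=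
    contMDiffAt_const.prodMk_space h2
  refine h3.congr_of_eventuallyEq ?_
  have : ∀ᶠ q : TM E M in nhds p, q.proj ∈ (extChartAt 𝓘(ℝ, E) p.proj).source :=
    (contMDiff_proj (E := E) (M := M)).continuous.continuousAt.eventually_mem
      (extChartAt_source_mem_nhds (I := 𝓘(ℝ, E)) p.proj)
  filter_upwards [this] with q hq
  exact mfderiv_extChartAt_TM_vertical hq _

theorem contMDiffAt_modifiedField (hx0 : ContMDiff 𝓘(ℝ, E) 𝓘(ℝ, ℝ) ∞ x0)
    (hD : SmoothFieldOn (modelTM E) D univ) {p : TM E M} (hp : p ∈ regularDomain g x0) :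
    ContMDiffAt (modelTM E) (modelTM E).tangent ∞
      (fun q => (⟨q, modifiedField g x0 D q⟩ : TangentBundle (modelTM E) (TM E M))) p := by
  have hD' : ContMDiff (modelTM E) (modelTM E).tangent ∞
      (fun q => (⟨q, D q⟩ : TangentBundle (modelTM E) (TM E M))) := contMDiffOn_univ.1 hD
  have h1 : ContMDiff (modelTM E) 𝓘(ℝ, ℝ) ∞ (fun q : TM E M => modelD (dot x0) q (D q)) :=
    (contMDiff_snd_tangentBundle_modelSpace ℝ 𝓘(ℝ, ℝ)).comp
      (((contMDiff_dot hx0).contMDiff_tangentMap (by simp)).comp hD')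
  have h2 : ContMDiff (modelTM E) 𝓘(ℝ, ℝ) ∞ (fun q : TM E M =>
      modelInner g q.proj (modelGrad g x0 q.proj) (modelGrad g x0 q.proj)) := by
    -- ‖dx⁰‖² is ẋ⁰ evaluated on the gradient section.
    refine (((contMDiff_dot hx0).comp (contMDiff_grad g hx0)).comp contMDiff_proj).congr ?_
    intro q
    exact modelInner_modelGrad g x0 q.proj _
  have h3 := (h1 p).div₀ (h2 p) hp.2
  have h4 := (contMDiffAt_field_iff (J := modelTM E) D p).1 (hD' p)
  refine (contMDiffAt_field_iff (J := modelTM E) (modifiedField g x0 D) p).2 ?_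
  refine (h4.sub (h3.smul (contMDiffAt_verticalGrad g hx0 p))).congr_of_eventuallyEq ?_
  filter_upwards with q
  let L : E × E →L[ℝ] E × E := mfderiv (modelTM E) 𝓘(ℝ, E × E) (extChartAt (modelTM E) p) q
  have : ∀ (X Y : E × E) (c : ℝ), L (X - c • Y) = L X - c • L Y := fun X Y c => by
    rw [map_sub, map_smul]
  exact this _ _ _

theorem frequently_hamiltonian_ne_zero {p : TM E M} (hp : p ∈ regularDomain g x0) :
    ∃ᶠ q in nhds p, hamiltonian g U q ≠ 0 := by
  by_cases hH : hamiltonian g U p = 0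
  swap
  · exact fun h => h.self_of_nhds hH
  let G := modelInner g p.proj
  let k : E := modelGrad g x0 p.proj
  -- Along the vertical line v + t grad x⁰ the derivative of H at t = 0 is ẋ⁰(v) ≠ 0, so a zero of H
  -- at t = 0 is isolated on that line.
  have hlim : ∀ v : E, (G k v ≠ 0) → (1 / 2) * G v v + U p.proj = 0 →
      ∃ᶠ t : ℝ in nhds 0, (1 / 2) * G (v + t • k) (v + t • k) + U p.proj ≠ 0 := by
    intro v hv h0
    have hd : HasDerivAt (fun t : ℝ => (1 / 2) * G (v + t • k) (v + t • k) + U p.proj)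
        (G k v) 0 := by
      have e : (fun t : ℝ => (1 / 2) * G (v + t • k) (v + t • k) + U p.proj) =
          fun t => ((1 / 2) * G v v + U p.proj) + t * G k v + t ^ 2 * ((1 / 2) * G k k) := by
        funext t
        have := modelInner_symm g p.proj v k
        simp only [map_add, map_smul, add_apply, smul_apply, smul_eq_mul]
        change G v k = G k v at this
        rw [this]
        ring
      rw [e]
      have h1 := ((((hasDerivAt_id (0 : ℝ)).mul_const (G k v)).const_add
        ((1 / 2) * G v v + U p.proj)).add (((hasDerivAt_id (0 : ℝ)).pow 2).mul_const
          ((1 / 2) * G k k)))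
      convert! h1 using 1
      simp
    have := (hd.eventually_ne (c := 0) hv).frequently
    exact this.filter_mono nhdsWithin_le_nhds
  have hcont : ∀ v : E, Filter.Tendsto (fun t : ℝ => (⟨p.proj, v + t • k⟩ : TM E M)) (nhds 0)
      (nhds ⟨p.proj, v⟩) := by
    intro v
    have h1 : Continuous (fun w : E => (⟨p.proj, w⟩ : TM E M)) :=
      FiberBundle.continuous_totalSpaceMk E (TangentSpace 𝓘(ℝ, E)) p.proj
    have h2 : Filter.Tendsto (fun t : ℝ => v + t • k) (nhds 0) (nhds v) := by
      have h3 : Continuous (fun t : ℝ => v + t • k) := by fun_prop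
      simpa using h3.tendsto 0
    exact (h1.tendsto v).comp h2
  refine (hcont p.2).frequently (hlim p.2 ?_ hH)
  exact fun h => hp.1 ((dot_eq_modelInner g x0 p).trans h)

end Smoothness

/-! ### The barred equation for fields on TM and for sections. -/

section Sections

variable {E : Type*} [NormedAddCommGroup E] [NormedSpace ℝ E] [FiniteDimensional ℝ E]
  {M : Type*} [TopologicalSpace M] [ChartedSpace E M] [IsManifold 𝓘(ℝ, E) ∞ M]
  {g : PseudoMetric E M} {U x0 : M → ℝ} {D : FieldTM E M}

theorem newtonBar_iff (hU : ContMDiff 𝓘(ℝ, E) 𝓘(ℝ, ℝ) ∞ U)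
    (hx0 : ContMDiff 𝓘(ℝ, E) 𝓘(ℝ, ℝ) ∞ x0) (hD : IsMotionField g U D) {W : Set (TM E M)}
    (hW : IsOpen W) (hWR : W ⊆ regularDomain g x0) {X : FieldTM E M}
    (hX : SmoothFieldOn (modelTM E) X W) :
    NewtonBar g U x0 W X ↔ ∀ p ∈ W, X p = modifiedField g x0 D p := by
  constructor
  · intro h p hp
    have hf := (hX.contMDiffAt (hW.mem_nhds hp)).continuousAt
    have hf' := (contMDiffAt_modifiedField hx0 hD.smooth (hWR hp)).continuousAt
    have hfr : ∃ᶠ q in nhds p, (⟨q, X q⟩ : TangentBundle (modelTM E) (TM E M)) =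
        ⟨q, modifiedField g x0 D q⟩ := by
      -- Nearby points with H ≠ 0 are covered by the pointwise converse; continuity of both fields
      -- carries the equality to `p`.
      refine ((frequently_hamiltonian_ne_zero (U := U) (hWR hp)).and_eventually
        (hW.mem_nhds hp)).mono ?_
      rintro q ⟨hq, hqW⟩
      rw [eq_modifiedField_of_newtonBar hU hx0 hD (hWR hqW) hq (h q hqW)]
    have := eq_of_frequently_eq_bundle hf hf' rfl hfr
    exact TotalSpace.mk_injective p this
  · intro h p hp ξ
    rw [h p hp]
    exact newtonBar_modifiedField hU hx0 hD (hWR hp) ξ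

variable {u : (a : M) → TangentSpace 𝓘(ℝ, E) a} {N : Set M}

omit [FiniteDimensional ℝ E] in
theorem projDeriv_secDeriv (hN : IsOpen N) (hu : SmoothFieldOn 𝓘(ℝ, E) u N) {a : M} (ha : a ∈ N)
    (w : TangentSpace 𝓘(ℝ, E) a) : projDeriv (sec u a) (secDeriv u a w) = w := by
  have h1 : MDifferentiableAt 𝓘(ℝ, E) (modelTM E) (sec u) a :=
    (hu.contMDiffAt (hN.mem_nhds ha)).mdifferentiableAt (by simp)
  have h2 := mfderiv_comp_apply a (contMDiff_proj.mdifferentiable (by simp) (sec u a)) h1 w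
  refine h2.symm.trans ?_
  exact DFunLike.congr_fun (mfderiv_id (I := 𝓘(ℝ, E)) (x := a)) w

/-- If D̄ = u_*w, projecting to M gives w = u, because D̄ is of second order and u is a section. -/
theorem mem_range_secDeriv_iff (hN : IsOpen N) (hu : SmoothFieldOn 𝓘(ℝ, E) u N)
    (hD : IsMotionField g U D) {a : M} (ha : a ∈ N) :
    modifiedField g x0 D (sec u a) ∈ LinearMap.range (secDeriv u a).toLinearMap ↔
      secDeriv u a (u a) = modifiedField g x0 D (sec u a) := by
  constructor
  · rintro ⟨w, hw⟩
    have h1 := projDeriv_secDeriv hN hu ha w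
    have h2 : projDeriv (sec u a) (modifiedField g x0 D (sec u a)) = u a :=
      (projDeriv_apply _ _).trans (hD.modifiedField_fst (sec u a))
    have h3 : secDeriv u a w = modifiedField g x0 D (sec u a) := hw
    rw [← h3, h1] at h2
    rw [← h2, h3]
  · exact fun h => ⟨u a, h⟩

/-- Both terms are pull-backs by u: `extD_pullback` handles dθ̄, and the chain rule handles u⁰ =
u^*ẋ⁰. -/
theorem intermediateBar_at_eq (hU : ContMDiff 𝓘(ℝ, E) 𝓘(ℝ, ℝ) ∞ U)
    (hx0 : ContMDiff 𝓘(ℝ, E) 𝓘(ℝ, ℝ) ∞ x0) (hN : IsOpen N) (hu : SmoothFieldOn 𝓘(ℝ, E) u N)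
    {a : M} (ha : a ∈ N) (hR : sec u a ∈ regularDomain g x0) (w : TangentSpace 𝓘(ℝ, E) a) :
    extD (pullSec u (liouvilleBar g U x0)) a (u a) w
      + hamiltonian g U (sec u a) / dM x0 a (u a) * dM (fun b => dM x0 b (u b)) a w =
    extD (liouvilleBar g U x0) (sec u a) (secDeriv u a (u a)) (secDeriv u a w)
      + hamiltonian g U (sec u a) / dot x0 (sec u a) *
        dTM (dot x0) (sec u a) (secDeriv u a w) := by
  have h1 : MDifferentiableAt 𝓘(ℝ, E) (modelTM E) (sec u) a :=
    (hu.contMDiffAt (hN.mem_nhds ha)).mdifferentiableAt (by simp)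
  have h2 := extD_pullback (J := modelTM E) (J' := 𝓘(ℝ, E)) (f := sec u) (hN.mem_nhds ha) hu
    (β := liouvilleBar g U x0)
    (differentiableAt_chartRep_sub_smul (differentiableAt_chartRep_liouville g (sec u a))
      (mdifferentiableAt_hamiltonian_div_dot g hU hx0 hR.1) (contMDiff_lift hx0)) (u a) w
  have h3 := mvfderiv_comp_apply a ((contMDiff_dot hx0).mdifferentiable (by simp) (sec u a)) h1 w
  exact congrArg₂ (fun s t => s + hamiltonian g U (sec u a) / dot x0 (sec u a) * t) h2 h3

theorem isIntermediateIntegral_iff (hN : IsOpen N) (hu : SmoothFieldOn 𝓘(ℝ, E) u N)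
    (hD : IsMotionField g U D) :
    IsIntermediateIntegral (modifiedField g x0 D) N u ↔
      ∀ a ∈ N, secDeriv u a (u a) = modifiedField g x0 D (sec u a) :=
  forall₂_congr fun _ ha => mem_range_secDeriv_iff hN hu hD ha

omit [FiniteDimensional ℝ E] in
theorem continuousAt_secDeriv (hN : IsOpen N) (hu : SmoothFieldOn 𝓘(ℝ, E) u N) {a : M}
    (ha : a ∈ N) :
    ContinuousAt (fun b => (⟨sec u b, secDeriv u b (u b)⟩ : TangentBundle (modelTM E) (TM E M)))
      a := by
  have h1 := hu.continuousOn_tangentMapWithin (by simp) hN.uniqueMDiffOn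
  have h2 : ContinuousOn (sec u) N := hu.continuousOn
  -- The field u_*u is the tangent map of the section evaluated on the section itself, hence
  -- continuous.
  have h3 : ContinuousAt (fun b => tangentMapWithin 𝓘(ℝ, E) (modelTM E) (sec u) N (sec u b)) a :=
    (h1.comp h2 fun b hb => hb).continuousAt (hN.mem_nhds ha)
  refine h3.congr ?_
  filter_upwards [hN.mem_nhds ha] with b hb
  exact congrArg (fun L : E →L[ℝ] E × E => (⟨sec u b, L (u b)⟩ : TangentBundle (modelTM E) (TM E M)))
    (mfderivWithin_of_isOpen hN hb)

theorem intermediateBar_of_isIntermediateIntegral (hU : ContMDiff 𝓘(ℝ, E) 𝓘(ℝ, ℝ) ∞ U)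
    (hx0 : ContMDiff 𝓘(ℝ, E) 𝓘(ℝ, ℝ) ∞ x0) (hD : IsMotionField g U D) (hN : IsOpen N)
    (hu : SmoothFieldOn 𝓘(ℝ, E) u N) (hR : ∀ a ∈ N, sec u a ∈ regularDomain g x0)
    (h : IsIntermediateIntegral (modifiedField g x0 D) N u) : IntermediateBar g U x0 N u := by
  intro a ha w
  rw [intermediateBar_at_eq hU hx0 hN hu ha (hR a ha),
    (isIntermediateIntegral_iff hN hu hD).1 h a ha]
  exact newtonBar_modifiedField hU hx0 hD (hR a ha) _

theorem isIntermediateIntegral_of_intermediateBar (hU : ContMDiff 𝓘(ℝ, E) 𝓘(ℝ, ℝ) ∞ U)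
    (hx0 : ContMDiff 𝓘(ℝ, E) 𝓘(ℝ, ℝ) ∞ x0) (hD : IsMotionField g U D) (hN : IsOpen N)
    (hu : SmoothFieldOn 𝓘(ℝ, E) u N) (hR : ∀ a ∈ N, sec u a ∈ regularDomain g x0)
    (hdense : N ⊆ closure {a ∈ N | hamiltonian g U (sec u a) ≠ 0})
    (h : IntermediateBar g U x0 N u) : IsIntermediateIntegral (modifiedField g x0 D) N u := by
  refine (isIntermediateIntegral_iff hN hu hD).2 fun a ha => ?_
  have hsec : ContinuousAt (sec u) a := hu.continuousOn.continuousAt (hN.mem_nhds ha)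
  have hf' : ContinuousAt (fun b => (⟨sec u b, modifiedField g x0 D (sec u b)⟩ :
      TangentBundle (modelTM E) (TM E M))) a :=
    ContinuousAt.comp (g := fun q => (⟨q, modifiedField g x0 D q⟩ :
      TangentBundle (modelTM E) (TM E M)))
      (contMDiffAt_modifiedField hx0 hD.smooth (hR a ha)).continuousAt hsec
  have hfr : ∃ᶠ b in nhds a, (⟨sec u b, secDeriv u b (u b)⟩ :
      TangentBundle (modelTM E) (TM E M)) = ⟨sec u b, modifiedField g x0 D (sec u b)⟩ := by
    -- Density of H(u) ≠ 0 replaces the accumulation argument used on TM, since the vertical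
    -- direction leaves the section.
    refine (mem_closure_iff_frequently.1 (hdense ha)).mono ?_
    rintro b ⟨hb, hHb⟩
    have := eq_modifiedField_of_newtonBar_section hU hx0 hD (hR b hb) hHb (L := secDeriv u b)
      (projDeriv_secDeriv hN hu hb) fun w =>
        (intermediateBar_at_eq hU hx0 hN hu hb (hR b hb) w).symm.trans (h b hb w)
    exact congrArg (TotalSpace.mk _) this
  have := eq_of_frequently_eq_bundle (continuousAt_secDeriv hN hu ha) hf' rfl hfr
  exact TotalSpace.mk_injective _ this

end Sections

end TimeConstraint

end

open TimeConstraint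
theorem mainTheorem6 {E : Type*} [NormedAddCommGroup E] [NormedSpace ℝ E] [FiniteDimensional ℝ E]
    {M : Type*} [TopologicalSpace M] [ChartedSpace E M] [IsManifold 𝓘(ℝ, E) ∞ M]
    (g : PseudoMetric E M)
    (U : M → ℝ) (hU : ContMDiff 𝓘(ℝ, E) 𝓘(ℝ, ℝ) ∞ U)
    (x0 : M → ℝ) (hx0 : ContMDiff 𝓘(ℝ, E) 𝓘(ℝ, ℝ) ∞ x0)
    (D : FieldTM E M) (hD : IsMotionField g U D) :
    ∃ Dbar : FieldTM E M,
      SmoothFieldOn (modelTM E) Dbar (regularDomain g x0) ∧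
      IsTimeModification g D x0 (regularDomain g x0) Dbar ∧
      (∀ W : Set (TM E M), IsOpen W → W ⊆ regularDomain g x0 →
        ∀ X : FieldTM E M, SmoothFieldOn (modelTM E) X W →
          (IsTimeModification g D x0 W X ↔ ∀ p ∈ W, X p = Dbar p) ∧
          (NewtonBar g U x0 W X ↔ ∀ p ∈ W, X p = Dbar p)) ∧
      (∀ N : Set M, IsOpen N →
        ∀ u : (a : M) → TangentSpace 𝓘(ℝ, E) a, SmoothFieldOn 𝓘(ℝ, E) u N →
          (∀ a ∈ N, sec u a ∈ regularDomain g x0) →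
            (IsIntermediateIntegral Dbar N u → IntermediateBar g U x0 N u) ∧
            (N ⊆ closure {a ∈ N | hamiltonian g U (sec u a) ≠ 0} →
              (IsIntermediateIntegral Dbar N u ↔ IntermediateBar g U x0 N u))) := by
  refine ⟨modifiedField g x0 D,
    fun p hp => (contMDiffAt_modifiedField hx0 hD.smooth hp).contMDiffWithinAt,
    fun p hp => (isTimeModification_at_iff hx0 hp _).2 rfl,
    fun W hW hWR X hX => ⟨forall₂_congr fun p hp => isTimeModification_at_iff hx0 (hWR hp) _,
      newtonBar_iff hU hx0 hD hW hWR hX⟩,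
    fun N hN u hu hR => ⟨intermediateBar_of_isIntermediateIntegral hU hx0 hD hN hu hR,
      fun hdense => ⟨intermediateBar_of_isIntermediateIntegral hU hx0 hD hN hu hR,
        isIntermediateIntegral_of_intermediateBar hU hx0 hD hN hu hR hdense⟩⟩⟩
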